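/- **Theorem 3.2 (forward-backward splitting with Bregman distances).** *Notation.* Let $\mathcal X$ be a reflexive real Banach space. $\Gamma_0(\mathcal X)$ is the class of lower semicontinuous convex functions $f:\mathcal X\to\left]-\infty,+\infty\right]$ with $\operatorname{dom} f=\{x: f(x)<+\infty\}\neq\varnothing$; $f^*$ is the conjugate of $f$ and $\partial f$ its Moreau subdifferential; $\rightharpoonup$ denotes weak convergence. For $f$ Gâteaux differentiable on $\operatorname{int}\operatorname{dom} f\neq\varnothing$, the Bregman distance is $D^f(x,y)=f(x)-f(y)-\langle x-y,\nabla f(y)\rangle$ if $y\in\operatorname{int}\operatorname{dom} f$ and $D^f(x,y)=+\infty$ otherwise, and $D^f_C(y)=\inf_{x\in C}D^f(x,y)$. Such an $f$ is *Legendre* if $\partial f$ is locally bounded and single-valued on its domain, $\partial f^*$ is locally bounded on its domain, and $f$ is strictly convex on every convex subset of $\operatorname{dom}\partial f$. It is *cofinite* if $\operatorname{dom} f^*=\mathcal X^*$. We write $f\succcurlyeq g$ if $D^f(x,y)\ge D^g(x,y)$ for all $x\in\operatorname{dom} f$ and $y\in\operatorname{int}\operatorname{dom} f$. A function $g$ is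 *coercive* if $g(x)\to+\infty$ as $\|x\|\to+\infty$. A function $g$ is *uniformly convex at* $x\in\operatorname{dom} g$ if there is an increasing $\phi:[0,+\infty[\to[0,+\infty]$ vanishing only at $0$ such that $g(\alpha x+(1-\alpha)y)+\alpha(1-\alpha)\phi(\|x-y\|)\le\alpha g(x)+(1-\alpha)g(y)$ for all $y\in\operatorname{dom} g$ and $\alpha\in\left]0,1\right[$. We say that $\nabla g$ is *weakly sequentially continuous* if $u_n\rightharpoonup u$ with $u_n,u\in\operatorname{int}\operatorname{dom} g$ implies $\nabla g(u_n)\rightharpoonup\nabla g(u)$. The $f$-proximity operator of $\varphi$ is the set-valued map $$\operatorname{Prox}^f_\varphi(x^*)=\{x\in\mathcal X:\ \varphi(x)+f(x)-\langle x,x^*\rangle=\min(\varphi+f-x^*)(\mathcal X)<+\infty\},\qquad x^*\in\mathcal X^*.$$ *Setting.* Let $\mathcal X$ and $\mathcal Y$ be reflexive real Banach spaces, let $\varphi\in\Gamma_0(\mathcal X)$, let $\psi\in\Gamma_0(\mathcal Y)$ be Gâteaux differentiable on $\operatorname{int}\operatorname{dom}\psi\ne\varnothing$, let $L:\mathcal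 X\to\mathcal Y$ be bounded and linear, and let $S$ be the set of points at which $\varphi+\psi\circ L$ is finite and attains its minimum over $\mathcal X$. Let $f\in\Gamma_0(\mathcal X)$ be a Legendre function such that $S\cap\operatorname{int}\operatorname{dom} f\ne\varnothing$, $L(\operatorname{int}\operatorname{dom} f)\subset\operatorname{int}\operatorname{dom}\psi$, and $f\succcurlyeq\beta\,\psi\circ L$ for some $\beta>0$. Suppose that $f$ is cofinite or $-L^*(\operatorname{ran}\nabla\psi)\subset\operatorname{dom}\varphi^*$, and that $D^f(x,\cdot)$ is coercive for every $x\in\operatorname{int}\operatorname{dom} f$. Let $\varepsilon\in\left]0,\beta/(\beta+1)\right[$, let $(\eta_n)_{n\in\mathbb N}$ be a summable sequence in $[0,+\infty[$, and let $(\gamma_n)_{n\in\mathbb N}$ be a real sequence such that, for every $n$, $$\varepsilon\le\gamma_n\le\beta(1-\varepsilon)\quad\text{and}\quad(1+\eta_n)\gamma_n-\gamma_{n+1}\le\beta\eta_n .$$ Let $x_0\in\operatorname{int}\operatorname{dom} f$. *Conclusion.* The iteration $$x_{n+1}=\operatorname{Prox}^f_{\gamma_n\varphi}\big(\nabla f(x_n)-\gamma_nL^*\nabla\psi(Lx_n)\big),\qquad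 n\in\mathbb N,$$ is well defined: each set on the right is a singleton, with $x_{n+1}$ its element, and $x_n\in\operatorname{int}\operatorname{dom} f$ for all $n$. Moreover, there exists $\overline x\in S$ such that the following hold. 1. Suppose that one of the following holds: (a) $S\cap\overline{\operatorname{dom} f}$ is a singleton; (b) $\nabla f$ and $\nabla\psi$ are weakly sequentially continuous and $S\subset\operatorname{int}\operatorname{dom} f$; (c) $\operatorname{dom} f^*$ is open and $\nabla f$, $\nabla f^*$ and $\nabla\psi$ are weakly sequentially continuous. Then $x_n\rightharpoonup\overline x$. 2. Suppose that, for all bounded sequences $(u_n)$ and $(v_n)$ in $\operatorname{int}\operatorname{dom} f$, $D^f(u_n,v_n)\to0$ implies $u_n-v_n\to0$, and that one of the following holds: (a) $\varphi$ is uniformly convex at $\overline x$; (b) $\psi$ is uniformly convex at $L\overline x$ and there is $\kappa>0$ with $\|Lx\|\ge\kappa\|x\|$ for all $x\in\mathcal X$; (c) $\varliminf D^f_S(x_n)=0$. Then $x_n\to\overline x$. -/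

import Mathlib

open Filter Topology Set
open scoped ENNReal NNReal

namespace BregmanFB

noncomputable section

/-- A normed space is reflexive if the canonical embedding into its bidual is onto. -/
def IsReflexiveSpace (E : Type*) [NormedAddCommGroup E] [NormedSpace ℝ E] : Prop :=
  Function.Surjective (NormedSpace.inclusionInDoubleDual ℝ E)

section Convex

variable {E : Type*} [NormedAddCommGroup E] [NormedSpace ℝ E]

/-- Effective domain `dom f = {x | f x < +∞}`. -/
def effDom (f : E → EReal) : Set E := {x | f x < ⊤}

/-- `int dom f`. -/
def intDom (f : E → EReal) : Set E := interior (effDom f)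

/-- `Γ₀(E)`: proper lower semicontinuous convex functions with values in `]-∞, +∞]`. -/
structure IsGammaZero (f : E → EReal) : Prop where
  ne_bot : ∀ x, f x ≠ ⊥
  nonempty_dom : (effDom f).Nonempty
  lsc : LowerSemicontinuous f
  convex : ∀ x y : E, ∀ t : ℝ, 0 < t → t < 1 →
    f (t • x + (1 - t) • y) ≤ (t : EReal) * f x + ((1 - t : ℝ) : EReal) * f y

/-- `ξ` is the Gâteaux derivative of `f` at `y`: every directional derivative of `f` at `y` exists
and is given by the continuous linear functional `ξ`. It is used at points `y ∈ int dom f`, around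
which the functions considered here are finite. -/
def HasGateauxDerivAt (f : E → EReal) (ξ : StrongDual ℝ E) (y : E) : Prop :=
  ∀ v : E, HasLineDerivAt ℝ (fun x => (f x).toReal) (ξ v) y v

/-- `f` is Gâteaux differentiable on `int dom f`, and `int dom f` is nonempty. -/
def GateauxOnIntDom (f : E → EReal) : Prop :=
  (intDom f).Nonempty ∧ ∀ y ∈ intDom f, ∃ ξ, HasGateauxDerivAt f ξ y

open Classical in
/-- The Gâteaux gradient `∇f`, with the value `0` where `f` has no Gâteaux derivative. -/
def grad (f : E → EReal) (y : E) : StrongDual ℝ E :=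
  if h : ∃ ξ, HasGateauxDerivAt f ξ y then h.choose else 0

/-- The conjugate `f* : E* → [-∞, +∞]`. -/
def conj (f : E → EReal) (ξ : StrongDual ℝ E) : EReal :=
  ⨆ x : E, ((ξ x : ℝ) : EReal) - f x

/-- The Moreau subdifferential `∂f : E → 2^{E*}`. -/
def subdiff (f : E → EReal) (x : E) : Set (StrongDual ℝ E) :=
  {ξ | ∀ y : E, ((ξ (y - x) : ℝ) : EReal) + f x ≤ f y}

/-- `dom ∂f`. -/
def domSubdiff (f : E → EReal) : Set E := {x | (subdiff f x).Nonempty}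

/-- `∂f` is locally bounded at every point of its domain. -/
def SubdiffLocallyBounded (f : E → EReal) : Prop :=
  ∀ x ∈ domSubdiff f, ∃ U ∈ 𝓝 x, Bornology.IsBounded (⋃ y ∈ U, subdiff f y)

/-- `∂f` is locally bounded and single-valued on its domain. -/
def EssentiallySmooth (f : E → EReal) : Prop :=
  SubdiffLocallyBounded f ∧ ∀ x ∈ domSubdiff f, (subdiff f x).Subsingleton

/-- `∂f*` is locally bounded on its domain and `f` is strictly convex on every convex subset of
`dom ∂f`. -/
def EssentiallyStrictlyConvex (f : E → EReal) : Prop :=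
  SubdiffLocallyBounded (conj f) ∧
    ∀ C : Set E, C ⊆ domSubdiff f → Convex ℝ C →
      ∀ x ∈ C, ∀ y ∈ C, x ≠ y → ∀ t : ℝ, 0 < t → t < 1 →
        f (t • x + (1 - t) • y) < (t : EReal) * f x + ((1 - t : ℝ) : EReal) * f y

/-- Legendre functions: Gâteaux differentiable on `int dom f ≠ ∅`, essentially smooth and
essentially strictly convex. -/
structure IsLegendre (f : E → EReal) : Prop where
  gateaux : GateauxOnIntDom f
  smooth : EssentiallySmooth f
  strict : EssentiallyStrictlyConvex f

/-- `f` is cofinite: `dom f* = E*`. -/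
def Cofinite (f : E → EReal) : Prop := effDom (conj f) = univ

/-- `g(x) → +∞` as `‖x‖ → +∞`. -/
def Coercive (g : E → EReal) : Prop := Tendsto g (Bornology.cobounded E) (𝓝 ⊤)

open Classical in
/-- The Bregman distance `D^f(x, y)`. -/
def bregman (f : E → EReal) (x y : E) : EReal :=
  if y ∈ intDom f then f x - f y - ((grad f y (x - y) : ℝ) : EReal) else ⊤

/-- The `D^f`-distance from `y` to `C`. -/
def bregmanDist (f : E → EReal) (C : Set E) (y : E) : EReal := ⨅ x ∈ C, bregman f x y

/-- The relation `g₁ ≽ g₂` relative to `f`: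
`D^{g₁}(x, y) ≥ D^{g₂}(x, y)` for all `x ∈ dom f` and `y ∈ int dom f`. -/
def Dominates (f g₁ g₂ : E → EReal) : Prop :=
  ∀ x ∈ effDom f, ∀ y ∈ intDom f, bregman g₂ x y ≤ bregman g₁ x y

/-- For bounded sequences in `int dom f`, `D^f(xₙ, yₙ) → 0` implies `xₙ - yₙ → 0`. -/
def BregmanSeqConsistent (f : E → EReal) : Prop :=
  ∀ x y : ℕ → E, (∀ n, x n ∈ intDom f) → (∀ n, y n ∈ intDom f) →
    Bornology.IsBounded (range x) → Bornology.IsBounded (range y) →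
    Tendsto (fun n => bregman f (x n) (y n)) atTop (𝓝 0) →
    Tendsto (fun n => x n - y n) atTop (𝓝 0)

/-- `f` is uniformly convex at the point `x ∈ dom f`: there is an increasing modulus
`ϕ : [0, +∞[ → [0, +∞]` vanishing only at `0`. -/
def UniformlyConvexAt (f : E → EReal) (x : E) : Prop :=
  x ∈ effDom f ∧ ∃ ϕ : ℝ≥0 → ℝ≥0∞, Monotone ϕ ∧ (∀ t, ϕ t = 0 ↔ t = 0) ∧
    ∀ y ∈ effDom f, ∀ a : ℝ, 0 < a → a < 1 →
      f (a • x + (1 - a) • y) + ((a * (1 - a) : ℝ) : EReal) * ((ϕ ‖x - y‖₊ : ℝ≥0∞) : EReal)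
        ≤ (a : EReal) * f x + ((1 - a : ℝ) : EReal) * f y

/-- Weak convergence of a sequence. -/
def WeakTendsto (u : ℕ → E) (l : E) : Prop :=
  Tendsto (fun n => toWeakSpace ℝ E (u n)) atTop (𝓝 (toWeakSpace ℝ E l))

/-- The operator `∇f : int dom f → E*` is weakly sequentially continuous. -/
def GradWeakSeqContinuous (f : E → EReal) : Prop :=
  ∀ u : ℕ → E, ∀ l : E, (∀ n, u n ∈ intDom f) → l ∈ intDom f → WeakTendsto u l →
    WeakTendsto (fun n => grad f (u n)) (grad f l)

/-- The scaled function `γ φ`, for `γ > 0`. -/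
def scale (γ : ℝ) (φ : E → EReal) (x : E) : EReal := (γ : EReal) * φ x

/-- The `f`-proximity operator of `φ`, as a set-valued map `E* → 2^E`. -/
def proxOp (f φ : E → EReal) (ξ : StrongDual ℝ E) : Set E :=
  {x | φ x + f x - ((ξ x : ℝ) : EReal) < ⊤ ∧
    ∀ y : E, φ x + f x - ((ξ x : ℝ) : EReal) ≤ φ y + f y - ((ξ y : ℝ) : EReal)}

end Convex

section Problem

variable {X Y : Type*} [NormedAddCommGroup X] [NormedSpace ℝ X]
  [NormedAddCommGroup Y] [NormedSpace ℝ Y]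

/-- The solutions of the problem of minimizing `φ + ψ ∘ L`: the points at which this function is
finite and attains its global minimum. -/
def solutions (φ : X → EReal) (ψ : Y → EReal) (L : X →L[ℝ] Y) : Set X :=
  {x | φ x + ψ (L x) < ⊤ ∧ ∀ z : X, φ x + ψ (L x) ≤ φ z + ψ (L z)}

/-- The adjoint `L* : Y* → X*`, `L* ξ = ξ ∘ L`. -/
def adj (L : X →L[ℝ] Y) (ξ : StrongDual ℝ Y) : StrongDual ℝ X := ξ.comp L

/-- The forward-backward step at `x`: the set
`Prox^f_{γφ}(∇f(x) - γ L*∇ψ(Lx))`. -/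
def fbStep (f φ : X → EReal) (ψ : Y → EReal) (L : X →L[ℝ] Y) (γ : ℝ) (x : X) : Set X :=
  proxOp f (scale γ φ) (grad f x - γ • adj L (grad ψ (L x)))

end Problem

end

end BregmanFB

/-! The heart is a decrease estimate. Put `G = φ + ψ ∘ L`. Optimality in the proximal step, the
three-point identity for `D^f`, and `D^f ≥ β D^ψ(L·, L·)` with `γ n ≤ β` give, for `z ∈ dom φ ∩ dom
f`, `D^f(z, x (n+1)) + γ n (G (x (n+1)) - G z) ≤ D^f(z, x n)` (`realBregman_step_le`). For `z` a
minimizer of `G` in `dom f`, and since `γ n ≥ ε`, the distances `D^f(z, x n)` decrease and `G (x n)`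
tends to the minimum; coercivity of `D^f(z, ·)` for one such `z ∈ int dom f` bounds the orbit.
Sublevel sets of `G` are weakly closed, so every weak cluster point is a solution, and `xbar` is one
of them. These consequences are isolated in `BregmanMinimizing`. Weak convergence reduces to
uniqueness of the cluster point: trivial in the singleton case, otherwise an Opial-type argument
(`weak_limit_unique`), preceded in the last case by a duality argument placing cluster points in
`int dom f` (`mem_intDom_of_weakTendsto`). Strong convergence comes from the midpoint convexity gap
of `φ` or `ψ`, or from a Cauchy argument (`cauchySeq_of_liminf`). The steps are well defined
(`proxOp_scale_eq_singleton`) thanks to weak compactness, a Hahn–Banach sum rule, and the fact that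
local boundedness of `∂f` forces `dom ∂f = int dom f`. That fact, the inequality `f ≤ f**`, and its
use for `f*` all rest on minimizing `g + K‖· - y‖` (`exists_min_add_norm`). -/

namespace BregmanFB

set_option linter.unusedSectionVars false

noncomputable section

/-! ### Convexity and subgradients. -/

section Convex

variable {E : Type*} [NormedAddCommGroup E] [NormedSpace ℝ E]

/-! ### Functions in `Γ₀` -/

theorem IsGammaZero.coe_toReal {f : E → EReal} (hf : IsGammaZero f) {x : E} (hx : x ∈ effDom f) :
    ((f x).toReal : EReal) = f x :=
  EReal.coe_toReal (ne_of_lt hx) (hf.ne_bot x)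

theorem mem_effDom_of_le_coe {f : E → EReal} {x : E} {c : ℝ} (h : f x ≤ c) : x ∈ effDom f :=
  lt_of_le_of_lt h (EReal.coe_lt_top c)

theorem IsGammaZero.le_coe_iff {f : E → EReal} (hf : IsGammaZero f) {x : E} {c : ℝ} :
    f x ≤ c ↔ x ∈ effDom f ∧ (f x).toReal ≤ c := by
  constructor
  · intro h
    have hx := mem_effDom_of_le_coe h
    refine ⟨hx, ?_⟩
    rw [← hf.coe_toReal hx] at h
    exact_mod_cast h
  · rintro ⟨hx, h⟩
    rw [← hf.coe_toReal hx]
    exact_mod_cast h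

theorem IsGammaZero.mem_effDom_and_toReal_le {f : E → EReal} (hf : IsGammaZero f) {x y : E}
    (hx : x ∈ effDom f) (hy : y ∈ effDom f) {t : ℝ} (h0 : 0 ≤ t) (h1 : t ≤ 1) :
    t • x + (1 - t) • y ∈ effDom f ∧
      (f (t • x + (1 - t) • y)).toReal ≤ t * (f x).toReal + (1 - t) * (f y).toReal := by
  rcases h0.eq_or_lt with rfl | h0
  · simpa using hy
  rcases h1.eq_or_lt with rfl | h1
  · simpa using hx
  · rw [← hf.le_coe_iff]
    have := hf.convex x y t h0 h1
    rw [← hf.coe_toReal hx, ← hf.coe_toReal hy] at this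
    exact_mod_cast this

theorem IsGammaZero.convexOn {f : E → EReal} (hf : IsGammaZero f) :
    ConvexOn ℝ (effDom f) (fun x => (f x).toReal) := by
  refine ⟨fun x hx y hy a b ha hb hab => ?_, fun x hx y hy a b ha hb hab => ?_⟩
  · obtain rfl : b = 1 - a := by linarith
    exact (hf.mem_effDom_and_toReal_le hx hy ha (by linarith)).1
  · obtain rfl : b = 1 - a := by linarith
    exact (hf.mem_effDom_and_toReal_le hx hy ha (by linarith)).2

theorem IsGammaZero.convex_effDom {f : E → EReal} (hf : IsGammaZero f) : Convex ℝ (effDom f) :=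
  hf.convexOn.1

theorem IsGammaZero.convex_intDom {f : E → EReal} (hf : IsGammaZero f) : Convex ℝ (intDom f) :=
  hf.convex_effDom.interior

theorem intDom_subset_effDom {f : E → EReal} : intDom f ⊆ effDom f := interior_subset

theorem IsGammaZero.convex_sublevel {f : E → EReal} (hf : IsGammaZero f) (c : EReal) :
    Convex ℝ {x | f x ≤ c} := by
  intro x hx y hy a b ha hb hab
  obtain rfl : b = 1 - a := by linarith
  induction c using EReal.rec with
  | bot => exact absurd (le_bot_iff.1 hx) (hf.ne_bot x)
  | top => exact (le_top : f _ ≤ ⊤)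
  | coe c =>
    have hx' := hf.le_coe_iff.1 hx
    have hy' := hf.le_coe_iff.1 hy
    have := hf.mem_effDom_and_toReal_le hx'.1 hy'.1 ha (by linarith)
    refine hf.le_coe_iff.2 ⟨this.1, this.2.trans ?_⟩
    nlinarith [hx'.2, hy'.2]

theorem IsGammaZero.isClosed_sublevel {f : E → EReal} (hf : IsGammaZero f) (c : EReal) :
    IsClosed {x | f x ≤ c} :=
  hf.lsc.isClosed_preimage c

theorem lowerSemicontinuous_add_of_ne_bot {α : Type*} [TopologicalSpace α] {f g : α → EReal}
    (hf : LowerSemicontinuous f) (hg : LowerSemicontinuous g) (hf' : ∀ x, f x ≠ ⊥)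
    (hg' : ∀ x, g x ≠ ⊥) : LowerSemicontinuous fun x => f x + g x :=
  hf.add' hg fun x => EReal.continuousAt_add (Or.inr (hg' x)) (Or.inl (hf' x))

theorem add_lt_top_iff_of_ne_bot {a b : EReal} (ha : a ≠ ⊥) (hb : b ≠ ⊥) :
    a + b < ⊤ ↔ a < ⊤ ∧ b < ⊤ := by
  rw [lt_top_iff_ne_top, lt_top_iff_ne_top, lt_top_iff_ne_top, EReal.add_ne_top_iff_ne_top₂ ha hb]

theorem IsGammaZero.effDom_add {f g : E → EReal} (hf : IsGammaZero f) (hg : IsGammaZero g) :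
    effDom (fun x => f x + g x) = effDom f ∩ effDom g := by
  ext x
  exact add_lt_top_iff_of_ne_bot (hf.ne_bot x) (hg.ne_bot x)

theorem coe_mul_add_of_pos {t : ℝ} (ht : 0 < t) (a b : EReal) :
    (t : EReal) * (a + b) = t * a + t * b :=
  EReal.left_distrib_of_nonneg_of_ne_top (by exact_mod_cast ht.le) (EReal.coe_ne_top t) a b

theorem coe_mul_ne_bot_of_pos {t : ℝ} (ht : 0 < t) {a : EReal} (ha : a ≠ ⊥) :
    (t : EReal) * a ≠ ⊥ := by
  rw [EReal.mul_ne_bot]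
  simp [ht.le, ha]

theorem IsGammaZero.add {f g : E → EReal} (hf : IsGammaZero f) (hg : IsGammaZero g)
    (h : (effDom f ∩ effDom g).Nonempty) : IsGammaZero (fun x => f x + g x) where
  ne_bot x := EReal.add_ne_bot_iff.2 ⟨hf.ne_bot x, hg.ne_bot x⟩
  nonempty_dom := by rwa [hf.effDom_add hg]
  lsc := lowerSemicontinuous_add_of_ne_bot hf.lsc hg.lsc hf.ne_bot hg.ne_bot
  convex x y t h0 h1 := by
    rw [coe_mul_add_of_pos h0, coe_mul_add_of_pos (by linarith : 0 < 1 - t)]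
    calc _ ≤ _ := add_le_add (hf.convex x y t h0 h1) (hg.convex x y t h0 h1)
      _ = _ := by abel

theorem IsGammaZero.of_convexOn_univ {h : E → ℝ} (hc : Continuous h) (hh : ConvexOn ℝ univ h) :
    IsGammaZero (fun x => (h x : EReal)) where
  ne_bot x := EReal.coe_ne_bot _
  nonempty_dom := ⟨0, EReal.coe_lt_top _⟩
  lsc := (continuous_coe_real_ereal.comp hc).lowerSemicontinuous
  convex x y t h0 h1 := by
    have := hh.2 (mem_univ x) (mem_univ y) h0.le (by linarith : 0 ≤ 1 - t) (by ring)
    simp only [smul_eq_mul] at this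
    exact_mod_cast this

theorem effDom_scale {f : E → EReal} {γ : ℝ} (hγ : 0 < γ) : effDom (scale γ f) = effDom f := by
  ext x
  simp only [effDom, scale, mem_ofPred_eq, lt_top_iff_ne_top, EReal.mul_ne_top]
  simp [hγ, hγ.le]

theorem toReal_scale (f : E → EReal) (γ : ℝ) (x : E) :
    (scale γ f x).toReal = γ * (f x).toReal := by
  simp [scale, EReal.toReal_mul]

theorem IsGammaZero.scale {f : E → EReal} (hf : IsGammaZero f) {γ : ℝ} (hγ : 0 < γ) :
    IsGammaZero (scale γ f) where
  ne_bot x := coe_mul_ne_bot_of_pos hγ (hf.ne_bot x)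
  nonempty_dom := by rw [effDom_scale hγ]; exact hf.nonempty_dom
  lsc := by
    have hc : Continuous fun a : EReal => (γ : EReal) * a := by
      refine continuous_iff_continuousAt.2 fun a => ?_
      exact EReal.continuousAt_mul (p := ((γ : EReal), a)) (by simp [hγ.ne']) (by simp [hγ.ne'])
        (by simp) (by simp) |>.comp (by fun_prop : ContinuousAt (fun a : EReal => ((γ : EReal), a)) a)
    exact hc.comp_lowerSemicontinuous hf.lsc
      fun a b hab => mul_le_mul_of_nonneg_left hab (by exact_mod_cast hγ.le)
  convex x y t h0 h1 := by
    have h := mul_le_mul_of_nonneg_left (hf.convex x y t h0 h1)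
      (by exact_mod_cast hγ.le : (0 : EReal) ≤ γ)
    rw [coe_mul_add_of_pos hγ] at h
    simp only [BregmanFB.scale]
    rwa [mul_left_comm, mul_left_comm (γ : EReal) ((1 - t : ℝ) : EReal)] at h

theorem IsGammaZero.comp {F : Type*} [NormedAddCommGroup F] [NormedSpace ℝ F] {ψ : F → EReal}
    (hψ : IsGammaZero ψ) (L : E →L[ℝ] F) (h : ∃ x, L x ∈ effDom ψ) :
    IsGammaZero (fun x => ψ (L x)) where
  ne_bot x := hψ.ne_bot _
  nonempty_dom := h
  lsc := hψ.lsc.comp L.continuous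
  convex x y t h0 h1 := by
    rw [map_add, map_smul, map_smul]
    exact hψ.convex _ _ t h0 h1

/-! ### Subgradients and Gâteaux derivatives -/

theorem IsGammaZero.mem_subdiff_iff {f : E → EReal} (hf : IsGammaZero f) {x : E}
    {ξ : StrongDual ℝ E} : ξ ∈ subdiff f x ↔
      x ∈ effDom f ∧ ∀ y ∈ effDom f, ξ (y - x) + (f x).toReal ≤ (f y).toReal := by
  constructor
  · intro h
    have hx : x ∈ effDom f := by
      obtain ⟨z, hz⟩ := hf.nonempty_dom
      by_contra hx
      have hx' : f x = ⊤ := by simpa [effDom] using hx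
      have := h z
      rw [hx', EReal.coe_add_top] at this
      exact absurd (lt_of_le_of_lt this hz) (lt_irrefl _)
    refine ⟨hx, fun y hy => ?_⟩
    have := h y
    rw [← hf.coe_toReal hx, ← hf.coe_toReal hy] at this
    exact_mod_cast this
  · rintro ⟨hx, h⟩ y
    by_cases hy : y ∈ effDom f
    · rw [← hf.coe_toReal hx, ← hf.coe_toReal hy]
      exact_mod_cast h y hy
    · have hy' : f y = ⊤ := by simpa [effDom] using hy
      rw [hy']
      exact le_top

theorem eventually_add_smul_mem {s : Set E} {y v : E} (hy : y ∈ interior s) :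
    ∀ᶠ t : ℝ in 𝓝 0, y + t • v ∈ interior s := by
  have hc : Continuous fun t : ℝ => y + t • v := by fun_prop
  have : Tendsto (fun t : ℝ => y + t • v) (𝓝 0) (𝓝 y) := by simpa using hc.tendsto 0
  exact this (isOpen_interior.mem_nhds hy)

theorem exists_pos_add_smul_mem {s : Set E} {y v : E} (hy : y ∈ interior s) :
    ∃ t : ℝ, 0 < t ∧ y + t • v ∈ s := by
  have h1 : ∀ᶠ t : ℝ in 𝓝[>] 0, y + t • v ∈ interior s :=
    nhdsWithin_le_nhds (eventually_add_smul_mem hy)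
  obtain ⟨t, ht, ht0⟩ := (h1.and self_mem_nhdsWithin).exists
  exact ⟨t, ht0, interior_subset ht⟩

theorem HasGateauxDerivAt.tendsto_slope {f : E → EReal} {ξ : StrongDual ℝ E} {y : E}
    (h : HasGateauxDerivAt f ξ y) (v : E) :
    Tendsto (fun t : ℝ => ((f (y + t • v)).toReal - (f y).toReal) / t) (𝓝[>] 0) (𝓝 (ξ v)) := by
  have h1 : HasDerivAt (fun t : ℝ => (f (y + t • v)).toReal) (ξ v) 0 := h v
  have h2 := h1.tendsto_slope_zero_right
  refine h2.congr fun t => ?_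
  simp [div_eq_inv_mul]

theorem HasGateauxDerivAt.mem_subdiff {f : E → EReal} (hf : IsGammaZero f) {ξ : StrongDual ℝ E}
    {y : E} (h : HasGateauxDerivAt f ξ y) (hy : y ∈ effDom f) : ξ ∈ subdiff f y := by
  refine hf.mem_subdiff_iff.2 ⟨hy, fun z hz => ?_⟩
  have h1 : ξ (z - y) ≤ (f z).toReal - (f y).toReal := by
    refine le_of_tendsto (h.tendsto_slope (z - y)) ?_
    filter_upwards [Ioo_mem_nhdsGT (zero_lt_one : (0 : ℝ) < 1)] with t ht
    have h2 := (hf.mem_effDom_and_toReal_le hz hy ht.1.le ht.2.le).2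
    have h3 : t • z + (1 - t) • y = y + t • (z - y) := by module
    rw [h3] at h2
    rw [div_le_iff₀ ht.1]
    linarith
  linarith

theorem HasGateauxDerivAt.unique {f : E → EReal} {ξ ξ' : StrongDual ℝ E} {y : E}
    (h : HasGateauxDerivAt f ξ y) (h' : HasGateauxDerivAt f ξ' y) : ξ = ξ' := by
  ext v
  exact tendsto_nhds_unique (h.tendsto_slope v) (h'.tendsto_slope v)

theorem HasGateauxDerivAt.grad_eq {f : E → EReal} {ξ : StrongDual ℝ E} {y : E}
    (h : HasGateauxDerivAt f ξ y) : grad f y = ξ := by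
  have hex : ∃ ξ, HasGateauxDerivAt f ξ y := ⟨ξ, h⟩
  rw [grad, dif_pos hex]
  exact hex.choose_spec.unique h

theorem GateauxOnIntDom.hasGateauxDerivAt {f : E → EReal} (h : GateauxOnIntDom f) {y : E}
    (hy : y ∈ intDom f) : HasGateauxDerivAt f (grad f y) y := by
  obtain ⟨ξ, hξ⟩ := h.2 y hy
  rwa [hξ.grad_eq]

/-- First order condition: if `h` is Gâteaux differentiable at a minimizer `p` of `g + h`, then
the negative of its derivative is a subgradient of `g`. -/
theorem HasGateauxDerivAt.neg_mem_subdiff_of_isMin {g h : E → EReal} (hg : IsGammaZero g)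
    {ξ : StrongDual ℝ E} {p : E} (hd : HasGateauxDerivAt h ξ p) (hpg : p ∈ effDom g)
    (hph : p ∈ intDom h)
    (hmin : ∀ y ∈ effDom g ∩ intDom h,
      (g p).toReal + (h p).toReal ≤ (g y).toReal + (h y).toReal) :
    -ξ ∈ subdiff g p := by
  refine hg.mem_subdiff_iff.2 ⟨hpg, fun y hy => ?_⟩
  have h1 : (g p).toReal - (g y).toReal ≤ ξ (y - p) := by
    refine ge_of_tendsto (hd.tendsto_slope (y - p)) ?_
    filter_upwards [Ioo_mem_nhdsGT (zero_lt_one : (0 : ℝ) < 1),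
      nhdsWithin_le_nhds (eventually_add_smul_mem (v := y - p) hph)] with t ht hin
    have h2 := hg.mem_effDom_and_toReal_le hy hpg ht.1.le ht.2.le
    have h3 : t • y + (1 - t) • p = p + t • (y - p) := by module
    rw [h3] at h2
    have h4 := hmin _ ⟨h2.1, hin⟩
    rw [le_div_iff₀ ht.1]
    linarith [h2.2]
  rw [neg_apply]
  linarith

/-- At an interior point of the domain a Gâteaux derivative is the only subgradient. -/
theorem HasGateauxDerivAt.eq_of_mem_subdiff {f : E → EReal} (hf : IsGammaZero f)
    {ξ ζ : StrongDual ℝ E} {y : E} (h : HasGateauxDerivAt f ξ y) (hy : y ∈ intDom f)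
    (hζ : ζ ∈ subdiff f y) : ζ = ξ := by
  have hle : ∀ v, ζ v ≤ ξ v := fun v => by
    refine ge_of_tendsto (h.tendsto_slope v) ?_
    filter_upwards [self_mem_nhdsWithin,
      nhdsWithin_le_nhds (eventually_add_smul_mem (v := v) hy)] with t ht hin
    have h1 := (hf.mem_subdiff_iff.1 hζ).2 _ (intDom_subset_effDom hin)
    rw [add_sub_cancel_left, map_smul, smul_eq_mul] at h1
    rw [le_div_iff₀ ht]
    linarith
  ext v
  have := hle (-v)
  rw [map_neg, map_neg] at this
  linarith [hle v]

/-! ### Subgradients at minimizers of a sum -/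

/-- Minimality at `p` says that the strict epigraph of `H` misses the hypograph of `G p + H p - G`.
A hyperplane separating them is, once shown not to be vertical, the graph of an affine function
through `(p, H p)`, whose slope is `u`. The bound on `H` near `z ∈ A` gives the epigraph an interior
point, as Hahn–Banach requires. -/
theorem exists_subgradient_of_isMin {A B : Set E} {G H : E → ℝ} (hG : ConvexOn ℝ A G)
    (hH : ConvexOn ℝ B H) {p : E} (hpA : p ∈ A) (hpB : p ∈ B)
    (hmin : ∀ y ∈ A, y ∈ B → G p + H p ≤ G y + H y) {z : E} (hz : z ∈ A) {U : Set E}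
    (hU : U ∈ 𝓝 z) (hUB : U ⊆ B) {M : ℝ} (hM : ∀ y ∈ U, H y ≤ M) :
    ∃ u : StrongDual ℝ E, (∀ y ∈ B, u (y - p) + H p ≤ H y) ∧
      ∀ y ∈ A, -u (y - p) + G p ≤ G y := by
  let S : Set (E × ℝ) := {q | q.1 ∈ B ∧ H q.1 < q.2}
  let T : Set (E × ℝ) := {q | q.1 ∈ A ∧ q.2 ≤ -G q.1 + (G p + H p)}
  have hS : Convex ℝ S := hH.convex_strict_epigraph
  have hT : Convex ℝ T := (hG.neg.add_const (G p + H p)).convex_hypograph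
  have hint : (z, M + 1) ∈ interior S := by
    rw [mem_interior_iff_mem_nhds]
    have h1 : U ×ˢ Ioi M ∈ 𝓝 (z, M + 1) := prod_mem_nhds hU (Ioi_mem_nhds (by linarith))
    exact mem_of_superset h1 fun q hq => ⟨hUB hq.1, (hM _ hq.1).trans_lt hq.2⟩
  have hdisj : Disjoint (interior S) T := by
    rw [Set.disjoint_left]
    intro q hq hq'
    obtain ⟨h1, h2⟩ := interior_subset hq
    obtain ⟨h3, h4⟩ := hq'
    have := hmin q.1 h3 h1
    linarith
  obtain ⟨F, s, hF0, hFS, hFT⟩ := geometric_hahn_banach_of_nonempty_interior hS hT hdisj ⟨_, hint⟩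
    ⟨(p, H p), hpA, by simp⟩
  set v : StrongDual ℝ E := F.comp (ContinuousLinearMap.inl ℝ E ℝ) with hv
  set a : ℝ := F (0, 1) with ha
  have hF : ∀ x r, F (x, r) = v x + a * r := by
    intro x r
    have : ((x, r) : E × ℝ) = (x, 0) + r • (0, 1) := by simp
    rw [this, map_add, map_smul, smul_eq_mul, hv, ha]
    simp [mul_comm]
  have hB : ∀ x ∈ B, v x + a * H x ≤ s := by
    intro x hx
    refine le_of_forall_pos_le_add fun e he => ?_
    by_cases h0 : a = 0
    · have h1 := hFS (x, H x + 1) ⟨hx, by simp⟩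
      rw [hF, h0] at h1
      rw [h0]
      linarith
    · have hd : 0 < e / |a| := div_pos he (abs_pos.2 h0)
      have h1 := hFS (x, H x + e / |a|) ⟨hx, by simpa using hd⟩
      rw [hF] at h1
      have h2 : -e ≤ a * (e / |a|) := by
        rw [← neg_le_neg_iff, neg_neg]
        calc -(a * (e / |a|)) ≤ |a * (e / |a|)| := neg_le_abs _
          _ = |a| * (e / |a|) := by rw [abs_mul, abs_of_pos hd]
          _ = e := by field_simp
          _ ≤ e := le_rfl
      linarith
  have hA : ∀ y ∈ A, s ≤ v y + a * (-G y + (G p + H p)) := by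
    intro y hy
    have := hFT (y, -G y + (G p + H p)) ⟨hy, le_rfl⟩
    rwa [hF] at this
  have hzU : z ∈ U := mem_of_mem_nhds hU
  have ha_nonpos : a ≤ 0 := by
    by_contra hpos
    push Not at hpos
    have h1 := hFS (z, max (M + 1) ((s - v z) / a + 1)) ⟨hUB hzU, by
      have := hM z hzU
      exact lt_of_lt_of_le (by linarith) (le_max_left _ _)⟩
    rw [hF] at h1
    have h2 := mul_le_mul_of_nonneg_left (le_max_right (M + 1) ((s - v z) / a + 1)) hpos.le
    have h3 : a * ((s - v z) / a + 1) = s - v z + a := by field_simp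
    linarith
  -- With `a = 0` the functional `v` would attain its maximum over the neighbourhood `U` at `z`,
  -- hence vanish, and then `F = 0`.
  have ha_neg : a < 0 := by
    refine lt_of_le_of_ne ha_nonpos fun h0 => ?_
    have h1 := hA z hz
    rw [h0, zero_mul, add_zero] at h1
    have hvU : ∀ y ∈ U, v y ≤ v z := fun y hy => by
      have := hB y (hUB hy)
      rw [h0, zero_mul, add_zero] at this
      linarith
    have hv0 : ∀ w : E, v w ≤ 0 := by
      intro w
      have h2 : ∀ᶠ t : ℝ in 𝓝[>] 0, z + t • w ∈ U := by
        have hc : Continuous fun t : ℝ => z + t • w := by fun_prop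
        have : Tendsto (fun t : ℝ => z + t • w) (𝓝 0) (𝓝 z) := by simpa using hc.tendsto 0
        exact nhdsWithin_le_nhds (this hU)
      obtain ⟨t, ht, ht0⟩ := (h2.and self_mem_nhdsWithin).exists
      have h3 := hvU _ ht
      rw [map_add, map_smul, smul_eq_mul] at h3
      have h4 : (0 : ℝ) < t := ht0
      by_contra hw
      push Not at hw
      nlinarith [mul_pos h4 hw]
    have hv00 : v = 0 := by
      ext w
      have := hv0 (-w)
      rw [map_neg] at this
      simpa using le_antisymm (hv0 w) (by linarith)
    refine hF0 (ContinuousLinearMap.ext fun q => ?_)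
    have := hF q.1 q.2
    rw [h0, hv00] at this
    simpa using this
  have hpe : s = v p + a * H p := by
    have h1 := hA p hpA
    have h2 := hB p hpB
    have : -G p + (G p + H p) = H p := by ring
    rw [this] at h1
    linarith
  refine ⟨(-a)⁻¹ • v, fun y hy => ?_, fun y hy => ?_⟩
  · have h1 := hB y hy
    rw [smul_apply, smul_eq_mul, map_sub, ← le_sub_iff_add_le,
      inv_mul_le_iff₀ (by linarith)]
    linarith
  · have h1 := hA y hy
    rw [smul_apply, smul_eq_mul, map_sub, ← le_sub_iff_add_le, neg_le,
      le_inv_mul_iff₀ (by linarith)]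
    linarith

end Convex

/-! ### Weak topology and boundedness. -/

section Weak

variable {E : Type*} [NormedAddCommGroup E] [NormedSpace ℝ E]

/-! ### Weak convergence in reflexive spaces -/

theorem isClosed_image_toWeakSpace {C : Set E} (hc : Convex ℝ C) (hC : IsClosed C) :
    IsClosed (toWeakSpace ℝ E '' C) := by
  have := hc.toWeakSpace_closure (𝕜 := ℝ)
  rw [hC.closure_eq] at this
  rw [this]
  exact isClosed_closure

theorem continuous_eval_toWeakSpace_symm (ζ : StrongDual ℝ E) :
    Continuous fun w : WeakSpace ℝ E => ζ ((toWeakSpace ℝ E).symm w) :=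
  WeakBilin.eval_continuous (topDualPairing ℝ E).flip ζ

theorem weakTendsto_iff {u : ℕ → E} {l : E} :
    WeakTendsto u l ↔ ∀ ζ : StrongDual ℝ E, Tendsto (fun n => ζ (u n)) atTop (𝓝 (ζ l)) := by
  refine ⟨fun h ζ => ((continuous_eval_toWeakSpace_symm ζ).tendsto _).comp h, fun h => ?_⟩
  have hinj : Function.Injective (topDualPairing ℝ E).flip := by
    intro x y hxy
    refine (NormedSpace.inclusionInDoubleDualLi (E := E) ℝ).injective ?_
    ext ζ
    exact LinearMap.congr_fun hxy ζ
  exact (WeakBilin.tendsto_iff_forall_eval_tendsto _ hinj).2 h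

theorem WeakTendsto.comp {u : ℕ → E} {l : E} (h : WeakTendsto u l) {k : ℕ → ℕ}
    (hk : Tendsto k atTop atTop) : WeakTendsto (u ∘ k) l :=
  Tendsto.comp (g := fun n => toWeakSpace ℝ E (u n)) h hk

theorem WeakTendsto.unique {u : ℕ → E} {l l' : E} (h : WeakTendsto u l)
    (h' : WeakTendsto u l') : l = l' := by
  refine (NormedSpace.inclusionInDoubleDualLi (E := E) ℝ).injective ?_
  ext ζ
  exact tendsto_nhds_unique (weakTendsto_iff.1 h ζ) (weakTendsto_iff.1 h' ζ)

theorem WeakTendsto.mem_of_isClosed_of_convex {u : ℕ → E} {l : E} (h : WeakTendsto u l)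
    {C : Set E} (hc : Convex ℝ C) (hC : IsClosed C) (hu : ∀ᶠ n in atTop, u n ∈ C) : l ∈ C := by
  have h1 := (isClosed_image_toWeakSpace hc hC).mem_of_tendsto h
    (hu.mono fun n hn => mem_image_of_mem _ hn)
  simpa using h1

theorem IsReflexiveSpace.dual (hE : IsReflexiveSpace E) : IsReflexiveSpace (StrongDual ℝ E) := by
  intro F
  refine ⟨F.comp (NormedSpace.inclusionInDoubleDual ℝ E), ?_⟩
  ext z
  obtain ⟨x, rfl⟩ := hE z
  simp

theorem IsReflexiveSpace.isCompact_image_toWeakSpace (hE : IsReflexiveSpace E) {C : Set E}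
    (hc : Convex ℝ C) (hC : IsClosed C) (hb : Bornology.IsBounded C) :
    IsCompact (toWeakSpace ℝ E '' C) := by
  rw [← (isClosed_image_toWeakSpace hc hC).closure_eq]
  refine NormedSpace.isCompact_closure_of_isBounded ℝ E _ ?_ ?_
  · rwa [preimage_image_eq _ (toWeakSpace ℝ E).injective]
  · intro F _
    obtain ⟨x, hx⟩ := hE (WeakDual.toStrongDual F)
    refine ⟨toWeakSpace ℝ E x, ?_⟩
    exact DFunLike.ext _ _ fun ζ => DFunLike.congr_fun hx ζ

/-- In a reflexive space, a function with closed convex sublevel sets, one of which is nonempty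
and bounded, has a minimizer. -/
theorem IsReflexiveSpace.exists_isMin (hE : IsReflexiveSpace E) {g : E → EReal}
    (hc : ∀ c, Convex ℝ {x | g x ≤ c}) (hC : ∀ c, IsClosed {x | g x ≤ c}) {z : E}
    (hb : Bornology.IsBounded {x | g x ≤ g z}) : ∃ p, ∀ y, g p ≤ g y := by
  have hlsc : LowerSemicontinuous fun w => g ((toWeakSpace ℝ E).symm w) := by
    refine lowerSemicontinuous_iff_isClosed_preimage.2 fun c => ?_
    have h1 : (fun w => g ((toWeakSpace ℝ E).symm w)) ⁻¹' Iic c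
        = toWeakSpace ℝ E '' {x | g x ≤ c} := by
      rw [LinearEquiv.image_eq_preimage_symm]
      rfl
    rw [h1]
    exact isClosed_image_toWeakSpace (hc c) (hC c)
  obtain ⟨w, hw, hmin⟩ := (hlsc.lowerSemicontinuousOn _).exists_isMinOn
    (⟨_, mem_image_of_mem _ (le_refl (g z))⟩ : (toWeakSpace ℝ E '' {x | g x ≤ g z}).Nonempty)
    (hE.isCompact_image_toWeakSpace (hc _) (hC _) hb)
  refine ⟨(toWeakSpace ℝ E).symm w, fun y => ?_⟩
  by_cases hy : g y ≤ g z
  · simpa using isMinOn_iff.1 hmin _ (mem_image_of_mem (toWeakSpace ℝ E) hy)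
  · obtain ⟨x, hx, rfl⟩ := hw
    simpa using le_trans hx (not_le.1 hy).le

/-- Bounded sequences in a reflexive space have weakly convergent subsequences. -/
theorem IsReflexiveSpace.exists_weakTendsto_subseq (hE : IsReflexiveSpace E) {u : ℕ → E}
    (hu : Bornology.IsBounded (range u)) :
    ∃ l : E, ∃ k : ℕ → ℕ, StrictMono k ∧ WeakTendsto (u ∘ k) l := by
  obtain ⟨R, hR⟩ := hu.subset_closedBall 0
  have hR' : ∀ n, ‖u n‖ ≤ R := fun n => by simpa using hR (mem_range_self n)
  set M : Submodule ℝ E := (Submodule.span ℝ (range u)).topologicalClosure with hM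
  have huM : ∀ n, u n ∈ M := fun n =>
    Submodule.le_topologicalClosure _ (Submodule.subset_span (mem_range_self n))
  have hsep : TopologicalSpace.IsSeparable (M : Set E) := by
    rw [hM, Submodule.topologicalClosure_coe]
    exact ((countable_range u).isSeparable.span (R := ℝ)).closure
  obtain ⟨c, hcc, hc⟩ := hsep
  have : Countable c := hcc.to_subtype
  choose d hd1 hd2 using fun y : E => exists_dual_vector'' ℝ y
  -- Countably many norming functionals separate the points of `M`: if `y ∈ c` is close to `m`, then
  -- `‖y‖ = d y y = d y (y - m) ≤ ‖y - m‖`, so `m` is small.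
  have hd : ∀ m ∈ M, (∀ y ∈ c, d y m = 0) → m = 0 := by
    intro m hm h0
    rw [← norm_le_zero_iff]
    refine le_of_forall_pos_le_add fun e he => ?_
    obtain ⟨y, hy, hmy⟩ := Metric.mem_closure_iff.1 (hc hm) (e / 2) (by linarith)
    have h1 : ‖y‖ ≤ e / 2 := by
      have h2 : (‖y‖ : ℝ) = d y (y - m) := by rw [map_sub, h0 y hy, sub_zero, hd2]; simp
      rw [h2]
      calc d y (y - m) ≤ ‖d y (y - m)‖ := Real.le_norm_self _
        _ ≤ 1 * ‖y - m‖ := (d y).le_of_opNorm_le (hd1 y) _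
        _ ≤ e / 2 := by rw [one_mul, ← dist_eq_norm, dist_comm]; exact hmy.le
    have h3 : ‖m‖ ≤ ‖m - y‖ + ‖y‖ := by simpa using norm_add_le (m - y) y
    rw [← dist_eq_norm] at h3
    linarith
  -- The diagonal extraction: a countable product of intervals is sequentially compact, so along one
  -- subsequence every `d y (u (k n))` converges. All weak cluster points of it lie in `M` and share
  -- these values, hence coincide, and weak compactness of the ball turns uniqueness into
  -- convergence.
  have hKc : IsCompact (Set.pi univ fun _ : c => Icc (-R) R) :=
    isCompact_univ_pi fun _ => isCompact_Icc
  obtain ⟨w, -, k, hk, hw⟩ := hKc.isSeqCompact (x := fun n (y : c) => d y (u n)) fun n y _ => by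
    refine abs_le.1 ?_
    rw [← Real.norm_eq_abs]
    calc ‖d y (u n)‖ ≤ 1 * ‖u n‖ := (d y).le_of_opNorm_le (hd1 y) _
      _ ≤ R := by rw [one_mul]; exact hR' n
  have hBall := hE.isCompact_image_toWeakSpace (convex_closedBall (0 : E) R)
    Metric.isClosed_closedBall Metric.isBounded_closedBall
  have hmem : ∀ n, toWeakSpace ℝ E (u (k n)) ∈ toWeakSpace ℝ E '' Metric.closedBall 0 R :=
    fun n => mem_image_of_mem _ (hR (mem_range_self _))
  have hcl : ∀ x : E, MapClusterPt (toWeakSpace ℝ E x) atTop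
      (fun n => toWeakSpace ℝ E (u (k n))) → x ∈ M ∧ ∀ y : c, d y x = w y := by
    intro x hx
    constructor
    · have h1 : IsClosed (toWeakSpace ℝ E '' (M : Set E)) :=
        isClosed_image_toWeakSpace M.convex (Submodule.isClosed_topologicalClosure _)
      have h2 := h1.mem_of_mapClusterPt hx
        (Eventually.of_forall fun n => mem_image_of_mem _ (huM (k n)))
      simpa using h2
    · intro y
      have h0 := (continuous_eval_toWeakSpace_symm (d y)).tendsto (toWeakSpace ℝ E x)
      have h1 := hx.tendsto_comp h0
      have h2 : Tendsto (fun n => d y (u (k n))) atTop (𝓝 (w y)) := (tendsto_pi_nhds.1 hw) y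
      have h3 : ClusterPt (d y x) (𝓝 (w y)) := h1.clusterPt.mono h2
      exact (eq_of_nhds_neBot (h3 : (𝓝 (d y x) ⊓ 𝓝 (w y)).NeBot))
  obtain ⟨l', hl', hl⟩ := hBall.exists_mapClusterPt (f := atTop)
    (u := fun n => toWeakSpace ℝ E (u (k n))) (by
      rw [le_principal_iff, mem_map]
      exact univ_mem' hmem)
  obtain ⟨l, -, rfl⟩ := hl'
  refine ⟨l, k, hk, ?_⟩
  refine hBall.tendsto_nhds_of_unique_mapClusterPt (Eventually.of_forall hmem) ?_
  rintro _ ⟨x, -, rfl⟩ hx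
  have h1 := hcl x hx
  have h2 := hcl l hl
  have h3 := hd (x - l) (M.sub_mem h1.1 h2.1) fun y hy => by
    rw [map_sub, h1.2 ⟨y, hy⟩, h2.2 ⟨y, hy⟩, sub_self]
  rw [sub_eq_zero.1 h3]

/-- A bounded sequence in a reflexive space converges weakly to `l` as soon as `l` is the limit
of each of its weakly convergent subsequences. -/
theorem IsReflexiveSpace.weakTendsto_of_unique (hE : IsReflexiveSpace E) {u : ℕ → E}
    (hu : Bornology.IsBounded (range u)) {l : E}
    (h : ∀ l' : E, ∀ k : ℕ → ℕ, Tendsto k atTop atTop → WeakTendsto (u ∘ k) l' → l' = l) :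
    WeakTendsto u l := by
  rw [weakTendsto_iff]
  intro ζ
  refine tendsto_of_subseq_tendsto fun ns hns => ?_
  obtain ⟨l', k, hk, hl'⟩ := hE.exists_weakTendsto_subseq (u := u ∘ ns)
    (hu.subset (range_comp_subset_range _ _))
  obtain rfl := h l' (ns ∘ k) (hns.comp hk.tendsto_atTop) hl'
  exact ⟨k, weakTendsto_iff.1 hl' ζ⟩

/-! ### Uniform boundedness -/

theorem isBounded_dual_of_forall_le [CompleteSpace E] {S : Set (StrongDual ℝ E)}
    (h : ∀ x : E, ∃ C, ∀ ξ ∈ S, ξ x ≤ C) : Bornology.IsBounded S := by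
  obtain ⟨C, hC⟩ := banach_steinhaus (g := fun ξ : S => (ξ : StrongDual ℝ E)) fun x => by
    obtain ⟨C₁, h₁⟩ := h x
    obtain ⟨C₂, h₂⟩ := h (-x)
    refine ⟨max C₁ C₂, fun ξ => ?_⟩
    rw [Real.norm_eq_abs, abs_le']
    refine ⟨(h₁ ξ ξ.2).trans (le_max_left _ _), ?_⟩
    rw [← map_neg]
    exact (h₂ ξ ξ.2).trans (le_max_right _ _)
  exact isBounded_iff_forall_norm_le.2 ⟨C, fun ξ hξ => hC ⟨ξ, hξ⟩⟩

theorem isBounded_of_forall_dual_le {S : Set E}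
    (h : ∀ ζ : StrongDual ℝ E, ∃ C, ∀ x ∈ S, ζ x ≤ C) : Bornology.IsBounded S := by
  have h1 : Bornology.IsBounded (NormedSpace.inclusionInDoubleDual ℝ E '' S) := by
    refine isBounded_dual_of_forall_le fun ζ => ?_
    obtain ⟨C, hC⟩ := h ζ
    refine ⟨C, ?_⟩
    rintro _ ⟨x, hx, rfl⟩
    exact hC x hx
  obtain ⟨C, hC⟩ := isBounded_iff_forall_norm_le.1 h1
  refine isBounded_iff_forall_norm_le.2 ⟨C, fun x hx => ?_⟩
  rw [← (NormedSpace.inclusionInDoubleDualLi (E := E) ℝ).norm_map x]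
  exact hC _ (mem_image_of_mem _ hx)

end Weak

/-! ### Duality in reflexive spaces. -/

section Conjugate

variable {E : Type*} [NormedAddCommGroup E] [NormedSpace ℝ E]

/-! ### Lipschitz regularization -/

theorem convexOn_mul_norm_sub {K : ℝ} (hK : 0 ≤ K) (y : E) :
    ConvexOn ℝ univ fun w : E => K * ‖w - y‖ := by
  have h := (convexOn_univ_norm (E := E)).translate_left (-y) |>.smul hK
  simpa [sub_eq_add_neg, Function.comp_def] using h

/-- Minimization of `g + K‖· - y‖` when `g` has an affine minorant of slope less than `K`. -/
theorem IsGammaZero.exists_min_add_norm (hE : IsReflexiveSpace E) {g : E → EReal}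
    (hg : IsGammaZero g) {u₀ : StrongDual ℝ E} {c K : ℝ}
    (hmin : ∀ w ∈ effDom g, u₀ w + c ≤ (g w).toReal) (hK : ‖u₀‖ < K) (y : E) :
    ∃ p, ∃ u ∈ subdiff g p, K * ‖p - y‖ ≤ u (y - p) ∧
      ∀ w ∈ effDom g, (g p).toReal + K * ‖p - y‖ ≤ (g w).toReal + K * ‖w - y‖ := by
  have hK0 : 0 ≤ K := (norm_nonneg _).trans hK.le
  set h : E → EReal := fun w => ((K * ‖w - y‖ : ℝ) : EReal) with hh
  have hhG : IsGammaZero h :=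
    IsGammaZero.of_convexOn_univ (by fun_prop) (convexOn_mul_norm_sub hK0 y)
  have hdh : effDom h = univ := eq_univ_of_forall fun w => EReal.coe_lt_top _
  obtain ⟨z, hz⟩ := hg.nonempty_dom
  have hsum : IsGammaZero fun w => g w + h w := hg.add hhG ⟨z, hz, by rw [hdh]; trivial⟩
  have hval : ∀ w ∈ effDom g, g w + h w = (((g w).toReal + K * ‖w - y‖ : ℝ) : EReal) :=
    fun w hw => by rw [EReal.coe_add, hg.coe_toReal hw]
  have hb : Bornology.IsBounded {w | g w + h w ≤ g z + h z} := by
    refine isBounded_iff_forall_norm_le.2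
      ⟨((g z).toReal + K * ‖z - y‖ - c + K * ‖y‖) / (K - ‖u₀‖), fun w hw => ?_⟩
    have h2 : g w + h w ≤ g z + h z := hw
    have hw' : w ∈ effDom g := by
      have h1 : w ∈ effDom fun w => g w + h w := by
        refine lt_of_le_of_lt h2 ?_
        rw [hval z hz]
        exact EReal.coe_lt_top _
      rw [hg.effDom_add hhG] at h1
      exact h1.1
    rw [hval w hw', hval z hz, EReal.coe_le_coe_iff] at h2
    have h3 := hmin w hw'
    have h4 : -(‖u₀‖ * ‖w‖) ≤ u₀ w := (abs_le.1 (u₀.le_opNorm w)).1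
    have h5 : ‖w‖ ≤ ‖w - y‖ + ‖y‖ := by simpa using norm_add_le (w - y) y
    rw [le_div_iff₀ (by linarith)]
    nlinarith
  obtain ⟨p, hp⟩ := hE.exists_isMin hsum.convex_sublevel hsum.isClosed_sublevel hb
  have hpd : p ∈ effDom g := by
    have h1 : p ∈ effDom fun w => g w + h w := by
      refine lt_of_le_of_lt (hp z) ?_
      rw [hval z hz]
      exact EReal.coe_lt_top _
    rw [hg.effDom_add hhG] at h1
    exact h1.1
  have hp' : ∀ w ∈ effDom g, (g p).toReal + K * ‖p - y‖ ≤ (g w).toReal + K * ‖w - y‖ := by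
    intro w hw
    have := hp w
    rwa [hval w hw, hval p hpd, EReal.coe_le_coe_iff] at this
  obtain ⟨u, hu1, hu2⟩ := exists_subgradient_of_isMin hg.convexOn (convexOn_mul_norm_sub hK0 y)
    hpd (mem_univ p) (fun w hw _ => hp' w hw) hz (Metric.ball_mem_nhds z one_pos)
    (subset_univ _) (M := K * (1 + ‖z - y‖)) fun w hw => by
      refine mul_le_mul_of_nonneg_left ?_ hK0
      have h1 : ‖w - z‖ < 1 := by simpa [dist_eq_norm] using hw
      have h2 := norm_add_le (w - z) (z - y)
      rw [sub_add_sub_cancel] at h2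
      linarith
  refine ⟨p, -u, hg.mem_subdiff_iff.2 ⟨hpd, fun w hw => by simpa using hu2 w hw⟩, ?_, hp'⟩
  -- The subgradient inequality of `K‖· - y‖` at `p` is tested at its minimizer `y`. Thus either `p
  -- = y` or the subgradient of `g` at `p` has norm at least `K`.
  have h1 := hu1 y (mem_univ y)
  rw [sub_self, norm_zero, mul_zero] at h1
  rw [neg_apply]
  linarith

theorem norm_le_of_apply_le {u : StrongDual ℝ E} {v : E} {K : ℝ} (h : K * ‖v‖ ≤ u v)
    (hv : v ≠ 0) : K ≤ ‖u‖ := by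
  have h1 := h.trans ((le_abs_self _).trans (u.le_opNorm v))
  exact le_of_mul_le_mul_right h1 (norm_pos_iff.2 hv)

/-- Where its subdifferential is nonempty and locally bounded, a function in `Γ₀` is calm from
above. -/
theorem IsGammaZero.exists_forall_ball_le (hE : IsReflexiveSpace E) {g : E → EReal}
    (hg : IsGammaZero g) (hlb : SubdiffLocallyBounded g) {x : E} (hx : x ∈ domSubdiff g) :
    ∃ r > 0, ∃ K : ℝ, ∀ y ∈ Metric.ball x r,
      y ∈ effDom g ∧ (g y).toReal ≤ (g x).toReal + K * ‖y - x‖ := by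
  obtain ⟨U, hU, hbd⟩ := hlb x hx
  obtain ⟨ρ, hρ, hball⟩ := Metric.mem_nhds_iff.1 hU
  obtain ⟨M, hM⟩ := isBounded_iff_forall_norm_le.1 hbd
  obtain ⟨u₀, hu₀⟩ := hx
  have hu₀' := hg.mem_subdiff_iff.1 hu₀
  have hu₀M : ‖u₀‖ ≤ M := hM _ (mem_biUnion (mem_of_mem_nhds hU) hu₀)
  have hM0 : 0 ≤ M := (norm_nonneg _).trans hu₀M
  refine ⟨ρ / (2 * (M + 1)), by positivity, M + 1, fun y hy => ?_⟩
  have hy' : ‖y - x‖ < ρ / (2 * (M + 1)) := by simpa [dist_eq_norm] using hy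
  obtain ⟨p, u, hu, hup, hp⟩ := hg.exists_min_add_norm hE (u₀ := u₀)
    (c := (g x).toReal - u₀ x) (K := M + 1) (fun w hw => by
      have := hu₀'.2 w hw
      rw [map_sub] at this
      linarith) (by linarith) y
  have hpd := (hg.mem_subdiff_iff.1 hu).1
  have h1 := hp x hu₀'.1
  have h2 := hu₀'.2 p hpd
  have h3 : -(M * ‖p - x‖) ≤ u₀ (p - x) :=
    (neg_le_neg (mul_le_mul_of_nonneg_right hu₀M (norm_nonneg _))).trans
      (abs_le.1 (u₀.le_opNorm (p - x))).1
  have h4 : ‖p - x‖ ≤ ‖p - y‖ + ‖y - x‖ := by simpa using norm_add_le (p - y) (y - x)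
  rw [norm_sub_rev x y] at h1
  -- Minimality of `p` against `x` and the affine minorant at `x` give `(M + 1)‖p - y‖ ≤ (M + 1)‖y -
  -- x‖ + M‖p - x‖`; the slope `M + 1`, one more than the bound on subgradients, lets `M‖p - x‖` be
  -- absorbed.
  have h5 : ‖p - x‖ ≤ 2 * (M + 1) * ‖y - x‖ := by nlinarith
  have h6 : 2 * (M + 1) * ‖y - x‖ < ρ := by
    rw [lt_div_iff₀ (by positivity)] at hy'
    linarith
  -- Otherwise `u` would be a subgradient of norm at least `M + 1` at a point of the ball where
  -- subgradients have norm at most `M`.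
  have hpy : p = y := by
    by_contra hne
    have h7 := norm_le_of_apply_le (v := y - p) (by rwa [norm_sub_rev y p])
      (sub_ne_zero.2 (Ne.symm hne))
    have h8 : p ∈ Metric.ball x ρ := by
      rw [Metric.mem_ball, dist_eq_norm]
      linarith
    have h9 := hM u (mem_biUnion (hball h8) hu)
    linarith
  subst hpy
  refine ⟨hpd, ?_⟩
  simpa using h1.trans (by simp)

theorem IsGammaZero.domSubdiff_subset_intDom (hE : IsReflexiveSpace E) {g : E → EReal}
    (hg : IsGammaZero g) (hlb : SubdiffLocallyBounded g) : domSubdiff g ⊆ intDom g := by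
  intro x hx
  obtain ⟨r, hr, K, h⟩ := hg.exists_forall_ball_le hE hlb hx
  rw [intDom, mem_interior_iff_mem_nhds]
  exact mem_of_superset (Metric.ball_mem_nhds x hr) fun y hy => (h y hy).1

/-! ### Conjugation -/

theorem IsGammaZero.conj_le_coe_iff {f : E → EReal} (hf : IsGammaZero f) {ξ : StrongDual ℝ E}
    {c : ℝ} : conj f ξ ≤ c ↔ ∀ x ∈ effDom f, ξ x - (f x).toReal ≤ c := by
  rw [conj, iSup_le_iff]
  refine ⟨fun h x hx => ?_, fun h x => ?_⟩
  · have := h x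
    rw [← hf.coe_toReal hx] at this
    exact_mod_cast this
  · by_cases hx : x ∈ effDom f
    · rw [← hf.coe_toReal hx]
      exact_mod_cast h x hx
    · have hx' : f x = ⊤ := by simpa [effDom] using hx
      rw [hx', EReal.sub_top]
      exact bot_le

theorem IsGammaZero.conj_ne_bot {f : E → EReal} (hf : IsGammaZero f) (ξ : StrongDual ℝ E) :
    conj f ξ ≠ ⊥ := by
  obtain ⟨z, hz⟩ := hf.nonempty_dom
  intro h
  have h1 : ((ξ z : ℝ) : EReal) - f z ≤ conj f ξ := le_iSup (fun x => ((ξ x : ℝ) : EReal) - f x) z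
  rw [h, ← hf.coe_toReal hz, ← EReal.coe_sub, le_bot_iff] at h1
  exact EReal.coe_ne_bot _ h1

theorem IsGammaZero.coe_toReal_conj {f : E → EReal} (hf : IsGammaZero f) {ξ : StrongDual ℝ E}
    (hξ : ξ ∈ effDom (conj f)) : ((conj f ξ).toReal : EReal) = conj f ξ :=
  EReal.coe_toReal (ne_of_lt hξ) (hf.conj_ne_bot ξ)

theorem IsGammaZero.fenchel_young {f : E → EReal} (hf : IsGammaZero f) {ξ : StrongDual ℝ E}
    (hξ : ξ ∈ effDom (conj f)) {x : E} (hx : x ∈ effDom f) :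
    ξ x ≤ (f x).toReal + (conj f ξ).toReal := by
  have := hf.conj_le_coe_iff.1 (hf.coe_toReal_conj hξ).ge x hx
  linarith

theorem IsGammaZero.conj {f : E → EReal} (hf : IsGammaZero f)
    (h : (effDom (conj f)).Nonempty) : IsGammaZero (conj f) where
  ne_bot := hf.conj_ne_bot
  nonempty_dom := h
  lsc := by
    refine lowerSemicontinuous_iSup fun x => ?_
    by_cases hx : x ∈ effDom f
    · have : (fun ξ : StrongDual ℝ E => ((ξ x : ℝ) : EReal) - f x)
          = fun ξ => ((ξ x - (f x).toReal : ℝ) : EReal) := by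
        funext ξ
        rw [EReal.coe_sub, hf.coe_toReal hx]
      rw [this]
      exact (continuous_coe_real_ereal.comp (by fun_prop)).lowerSemicontinuous
    · have hx' : f x = ⊤ := by simpa [effDom] using hx
      simp only [hx', EReal.sub_top]
      exact lowerSemicontinuous_const
  convex ξ ζ t h0 h1 := by
    by_cases hξ : ξ ∈ effDom (BregmanFB.conj f)
    swap
    · have : BregmanFB.conj f ξ = ⊤ := by simpa [effDom] using hξ
      rw [this, EReal.coe_mul_top_of_pos h0, EReal.top_add_of_ne_bot
        (coe_mul_ne_bot_of_pos (by linarith) (hf.conj_ne_bot ζ))]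
      exact le_top
    by_cases hζ : ζ ∈ effDom (BregmanFB.conj f)
    swap
    · have : BregmanFB.conj f ζ = ⊤ := by simpa [effDom] using hζ
      rw [this, EReal.coe_mul_top_of_pos (by linarith), EReal.add_top_of_ne_bot
        (coe_mul_ne_bot_of_pos h0 (hf.conj_ne_bot ξ))]
      exact le_top
    rw [← hf.coe_toReal_conj hξ, ← hf.coe_toReal_conj hζ, ← EReal.coe_mul, ← EReal.coe_mul,
      ← EReal.coe_add, hf.conj_le_coe_iff]
    intro x hx
    have h2 := hf.fenchel_young hξ hx
    have h3 := hf.fenchel_young hζ hx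
    simp only [add_apply, smul_apply, smul_eq_mul]
    nlinarith [mul_le_mul_of_nonneg_left h2 h0.le,
      mul_le_mul_of_nonneg_left h3 (by linarith : 0 ≤ 1 - t)]

theorem IsGammaZero.conj_eq_of_mem_subdiff {f : E → EReal} (hf : IsGammaZero f)
    {ξ : StrongDual ℝ E} {x : E} (h : ξ ∈ subdiff f x) :
    ξ ∈ effDom (BregmanFB.conj f) ∧ (BregmanFB.conj f ξ).toReal = ξ x - (f x).toReal := by
  rw [hf.mem_subdiff_iff] at h
  have h1 : BregmanFB.conj f ξ ≤ ((ξ x - (f x).toReal : ℝ) : EReal) := by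
    rw [hf.conj_le_coe_iff]
    intro y hy
    have := h.2 y hy
    rw [map_sub] at this
    linarith
  have h2 : ξ ∈ effDom (BregmanFB.conj f) := mem_effDom_of_le_coe h1
  refine ⟨h2, le_antisymm ?_ ?_⟩
  · rw [← hf.coe_toReal_conj h2] at h1
    exact_mod_cast h1
  · linarith [hf.fenchel_young h2 h.1]

theorem IsGammaZero.inclusion_mem_subdiff_conj {f : E → EReal} (hf : IsGammaZero f)
    {ξ : StrongDual ℝ E} {x : E} (h : ξ ∈ subdiff f x) :
    NormedSpace.inclusionInDoubleDual ℝ E x ∈ subdiff (BregmanFB.conj f) ξ := by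
  obtain ⟨h1, h2⟩ := hf.conj_eq_of_mem_subdiff h
  rw [(hf.conj ⟨ξ, h1⟩).mem_subdiff_iff]
  refine ⟨h1, fun ζ hζ => ?_⟩
  have h3 := hf.fenchel_young hζ (hf.mem_subdiff_iff.1 h).1
  rw [NormedSpace.dual_def, sub_apply, h2]
  linarith

/-- The Fenchel–Moreau inequality `f ≤ f**`. -/
theorem IsGammaZero.le_of_forall_conj (hE : IsReflexiveSpace E) {f : E → EReal}
    (hf : IsGammaZero f) (hdom : (effDom (BregmanFB.conj f)).Nonempty) {y : E} {b : ℝ}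
    (h : ∀ ζ ∈ effDom (BregmanFB.conj f), ζ y - (BregmanFB.conj f ζ).toReal ≤ b) : f y ≤ b := by
  obtain ⟨u₀, hu₀⟩ := hdom
  set c := -(BregmanFB.conj f u₀).toReal
  have hmin : ∀ w ∈ effDom f, u₀ w + c ≤ (f w).toReal := fun w hw => by
    have := hf.fenchel_young hu₀ hw
    simp only [c]
    linarith
  have hcl := (hf.isClosed_sublevel (b : EReal)).closure_eq
  have hmem : y ∈ closure {x | f x ≤ (b : EReal)} := by
    refine Metric.mem_closure_iff.2 fun e he => ?_
    -- Testing the hypothesis at a subgradient `u` at `p` gives `f p + u (y - p) ≤ b`, hence `f p ≤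
    -- b`. With the minorant `u₀ + c` it also gives `(d / e) ‖p - y‖ ≤ b - c - u₀ y < d`, which is
    -- why the excess slope is `d / e`.
    set d := |b - c - u₀ y| + 1 with hd
    have hd0 : 0 < d := by positivity
    obtain ⟨p, u, hu, hup, -⟩ := hf.exists_min_add_norm hE hmin (K := ‖u₀‖ + d / e)
      (lt_add_of_pos_right _ (div_pos hd0 he)) y
    obtain ⟨h1, h2⟩ := hf.conj_eq_of_mem_subdiff hu
    have hpd := (hf.mem_subdiff_iff.1 hu).1
    have h3 := h u h1
    rw [h2] at h3
    rw [map_sub] at hup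
    have h0 : 0 ≤ ‖p - y‖ := norm_nonneg _
    have h4 : 0 ≤ (‖u₀‖ + d / e) * ‖p - y‖ := by positivity
    refine ⟨p, hf.le_coe_iff.2 ⟨hpd, by linarith⟩, ?_⟩
    rw [dist_comm, dist_eq_norm]
    have h5 := hmin p hpd
    have h6 : -(‖u₀‖ * ‖p - y‖) ≤ u₀ (p - y) := (abs_le.1 (u₀.le_opNorm (p - y))).1
    rw [map_sub] at h6
    have h7 : d / e * ‖p - y‖ ≤ b - c - u₀ y := by linarith
    have h8 : d / e * ‖p - y‖ < d := by
      have := le_abs_self (b - c - u₀ y)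
      linarith
    have h9 : d / e * ‖p - y‖ = d * (‖p - y‖ / e) := by ring
    rw [h9] at h8
    have h10 : ‖p - y‖ / e < 1 := by
      by_contra hcon
      push Not at hcon
      nlinarith
    rwa [div_lt_one he] at h10
  rwa [hcl] at hmem

theorem IsGammaZero.mem_subdiff_of_inclusion_mem (hE : IsReflexiveSpace E) {f : E → EReal}
    (hf : IsGammaZero f) (hdom : (effDom (BregmanFB.conj f)).Nonempty) {ξ : StrongDual ℝ E}
    {x : E} (h : NormedSpace.inclusionInDoubleDual ℝ E x ∈ subdiff (BregmanFB.conj f) ξ) :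
    ξ ∈ subdiff f x := by
  rw [(hf.conj hdom).mem_subdiff_iff] at h
  have h1 : f x ≤ ((ξ x - (BregmanFB.conj f ξ).toReal : ℝ) : EReal) := by
    refine hf.le_of_forall_conj hE hdom fun ζ hζ => ?_
    have := h.2 ζ hζ
    rw [NormedSpace.dual_def, sub_apply] at this
    linarith
  rw [hf.le_coe_iff] at h1
  refine hf.mem_subdiff_iff.2 ⟨h1.1, fun w hw => ?_⟩
  have := hf.fenchel_young h.1 hw
  rw [map_sub]
  linarith [h1.2]

/-- `f - ξ` has bounded sublevel sets if `ξ` is interior to the domain of `f*`. -/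
theorem IsGammaZero.isBounded_sublevel_sub {f : E → EReal} (hf : IsGammaZero f)
    {ξ : StrongDual ℝ E} (hξ : ξ ∈ intDom (BregmanFB.conj f)) (c : ℝ) :
    Bornology.IsBounded {x | x ∈ effDom f ∧ (f x).toReal - ξ x ≤ c} := by
  refine isBounded_of_forall_dual_le fun ζ => ?_
  obtain ⟨t, ht0, ht⟩ := exists_pos_add_smul_mem (v := ζ) hξ
  refine ⟨((BregmanFB.conj f (ξ + t • ζ)).toReal + c) / t, ?_⟩
  rintro x ⟨hx, hxc⟩
  have h1 := hf.fenchel_young ht hx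
  simp only [add_apply, smul_apply, smul_eq_mul] at h1
  rw [le_div_iff₀ ht0]
  linarith

/-- A family of functionals with bounded `f* - ⟨z, ·⟩` is bounded if `z ∈ int dom f`. -/
theorem IsGammaZero.isBounded_sublevel_conj_sub [CompleteSpace E] {f : E → EReal}
    (hf : IsGammaZero f) {z : E} (hz : z ∈ intDom f) (c : ℝ) :
    Bornology.IsBounded
      {ξ | ξ ∈ effDom (BregmanFB.conj f) ∧ (BregmanFB.conj f ξ).toReal - ξ z ≤ c} := by
  refine isBounded_dual_of_forall_le fun v => ?_
  obtain ⟨t, ht0, ht⟩ := exists_pos_add_smul_mem (v := v) hz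
  refine ⟨((f (z + t • v)).toReal + c) / t, ?_⟩
  rintro ξ ⟨hξ, hξc⟩
  have h1 := hf.fenchel_young hξ ht
  simp only [map_add, map_smul, smul_eq_mul] at h1
  rw [le_div_iff₀ ht0]
  linarith

theorem IsGammaZero.sub_clm {f : E → EReal} (hf : IsGammaZero f) (ξ : StrongDual ℝ E) :
    IsGammaZero (fun x => f x - ((ξ x : ℝ) : EReal)) ∧
      effDom (fun x => f x - ((ξ x : ℝ) : EReal)) = effDom f ∧
      ∀ x ∈ effDom f, f x - ((ξ x : ℝ) : EReal) = (((f x).toReal - ξ x : ℝ) : EReal) := by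
  have h1 : IsGammaZero fun x => (((-ξ) x : ℝ) : EReal) :=
    IsGammaZero.of_convexOn_univ (-ξ).continuous ((-ξ).toLinearMap.convexOn convex_univ)
  have h2 : (fun x => f x - ((ξ x : ℝ) : EReal)) = fun x => f x + (((-ξ) x : ℝ) : EReal) := by
    funext x
    rw [sub_eq_add_neg, neg_apply, EReal.coe_neg]
  have h3 : effDom (fun x => (((-ξ) x : ℝ) : EReal)) = univ :=
    eq_univ_of_forall fun x => EReal.coe_lt_top _
  refine ⟨?_, ?_, fun x hx => ?_⟩
  · rw [h2]
    exact hf.add h1 (by rw [h3, inter_univ]; exact hf.nonempty_dom)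
  · rw [h2, hf.effDom_add h1, h3, inter_univ]
  · rw [EReal.coe_sub, hf.coe_toReal hx]

theorem IsGammaZero.exists_mem_subdiff_of_mem_intDom_conj (hE : IsReflexiveSpace E)
    {f : E → EReal} (hf : IsGammaZero f) {ξ : StrongDual ℝ E}
    (hξ : ξ ∈ intDom (BregmanFB.conj f)) : ∃ x, ξ ∈ subdiff f x := by
  obtain ⟨hg, hgd, hgv⟩ := hf.sub_clm ξ
  obtain ⟨z, hz⟩ := hf.nonempty_dom
  obtain ⟨p, hp⟩ := hE.exists_isMin hg.convex_sublevel hg.isClosed_sublevel (z := z) (by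
    refine (hf.isBounded_sublevel_sub hξ ((f z).toReal - ξ z)).subset fun x hx => ?_
    have h1 : f x - ((ξ x : ℝ) : EReal) ≤ f z - ((ξ z : ℝ) : EReal) := hx
    rw [hgv z hz] at h1
    have h2 : x ∈ effDom f := hgd ▸ mem_effDom_of_le_coe h1
    rw [hgv x h2, EReal.coe_le_coe_iff] at h1
    exact ⟨h2, h1⟩)
  have hpd : p ∈ effDom f := by
    have h1 := hp z
    rw [hgv z hz] at h1
    exact hgd ▸ mem_effDom_of_le_coe h1
  refine ⟨p, hf.mem_subdiff_iff.2 ⟨hpd, fun y hy => ?_⟩⟩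
  have h1 := hp y
  rw [hgv p hpd, hgv y hy, EReal.coe_le_coe_iff] at h1
  rw [map_sub]
  linarith

/-! ### Gâteaux differentiability from uniqueness of subgradients -/

/-- Any slope `a` between the left and right derivatives of `g` along `v` extends to a subgradient
`w` with `w v = a`: apply `exists_subgradient_of_isMin` to `g` and the linear function of slope `-a`
on the line. As `u` is the only candidate, both one-sided derivatives equal `u v`. -/
theorem IsGammaZero.hasGateauxDerivAt_of_subdiff_subset {g : E → EReal} (hg : IsGammaZero g)
    {x : E} {u : StrongDual ℝ E} (hsub : subdiff g x ⊆ {u}) {U : Set E} (hU : U ∈ 𝓝 x) {M : ℝ}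
    (hM : ∀ y ∈ U, y ∈ effDom g ∧ (g y).toReal ≤ M) : HasGateauxDerivAt g u x := by
  intro v
  have hUs : U ⊆ effDom g := fun y hy => (hM y hy).1
  have hxU : x ∈ U := mem_of_mem_nhds hU
  by_cases hv : v = 0
  · subst hv
    rw [map_zero]
    exact hasLineDerivAt_zero
  obtain ⟨d, hd1, hd2⟩ := exists_dual_vector ℝ v (norm_ne_zero_iff.2 hv)
  have hdv : d v = ‖v‖ := by simpa using hd2
  have hv0 : ‖v‖ ≠ 0 := norm_ne_zero_iff.2 hv
  set φ : ℝ → ℝ := fun t => (g (x + t • v)).toReal with hφ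
  have hconv : ConvexOn ℝ ((AffineMap.lineMap x (x + v) : ℝ →ᵃ[ℝ] E) ⁻¹' effDom g) φ := by
    have := hg.convexOn.comp_affineMap (AffineMap.lineMap x (x + v) : ℝ →ᵃ[ℝ] E)
    refine this.congr fun t _ => ?_
    simp [hφ, AffineMap.lineMap_apply, add_comm]
  have hline : ∀ t : ℝ, AffineMap.lineMap x (x + v) t = x + t • v := fun t => by
    simp [AffineMap.lineMap_apply, add_comm]
  have h0 : (0 : ℝ) ∈ interior ((AffineMap.lineMap x (x + v) : ℝ →ᵃ[ℝ] E) ⁻¹' effDom g) := by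
    rw [mem_interior_iff_mem_nhds]
    have hc : Continuous fun t : ℝ => x + t • v := by fun_prop
    have h1 : Tendsto (fun t : ℝ => x + t • v) (𝓝 0) (𝓝 x) := by simpa using hc.tendsto 0
    filter_upwards [h1 hU] with t ht
    rw [mem_preimage, hline]
    exact hUs ht
  have key : ∀ a : ℝ, derivWithin φ (Iio 0) 0 ≤ a → a ≤ derivWithin φ (Ioi 0) 0 → a = u v := by
    intro a ha1 ha2
    have hφa : ∀ t : ℝ, x + t • v ∈ effDom g → φ 0 + t * a ≤ φ t := by
      intro t ht
      rw [← hline, ← mem_preimage] at ht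
      rcases lt_trichotomy t 0 with h | h | h
      · have h1 := (hconv.slope_le_leftDeriv_of_mem_interior ht h0 h).trans ha1
        rw [slope_def_field, div_le_iff₀ (by linarith)] at h1
        linarith
      · simp [h]
      · have h1 := ha2.trans (hconv.rightDeriv_le_slope_of_mem_interior h0 ht h)
        rw [slope_def_field, le_div_iff₀ (by linarith)] at h1
        linarith
    have hGc : ConvexOn ℝ (range fun t : ℝ => x + t • v) fun y => -(a / ‖v‖) * d (y - x) := by
      have hA : Convex ℝ (range fun t : ℝ => x + t • v) := by
        have := (convex_univ (𝕜 := ℝ) (E := ℝ)).affine_image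
          (AffineMap.lineMap x (x + v) : ℝ →ᵃ[ℝ] E)
        rw [image_univ] at this
        rwa [show ⇑(AffineMap.lineMap x (x + v) : ℝ →ᵃ[ℝ] E) = fun t : ℝ => x + t • v from
          funext hline] at this
      refine ⟨hA, fun y _ z _ s t _ _ hst => le_of_eq ?_⟩
      have h1 : s • y + t • z - x = s • (y - x) + t • (z - x) := by
        have : x = (s + t) • x := by rw [hst, one_smul]
        nth_rewrite 1 [this]
        module
      simp only [h1, map_add, map_smul, smul_eq_mul]
      ring
    obtain ⟨w, hw1, hw2⟩ := exists_subgradient_of_isMin hGc hg.convexOn (p := x) ⟨0, by simp⟩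
      (hUs hxU) (by
        rintro _ ⟨t, rfl⟩ ht
        have h1 := hφa t ht
        simp only [hφ, zero_smul, add_zero] at h1
        simp only [add_sub_cancel_left, sub_self, map_zero, map_smul, smul_eq_mul, hdv, mul_zero]
        have h2 : a / ‖v‖ * (t * ‖v‖) = t * a := by field_simp
        linarith) (z := x) ⟨0, by simp⟩ hU hUs fun y hy => (hM y hy).2
    have hwu : w = u := hsub (hg.mem_subdiff_iff.2 ⟨hUs hxU, hw1⟩)
    have h1 := hw2 _ ⟨1, rfl⟩
    have h2 := hw2 _ ⟨-1, rfl⟩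
    simp only [one_smul, neg_smul, add_sub_cancel_left, sub_self, map_zero, map_neg, hdv,
      mul_zero] at h1 h2
    have h3 : a / ‖v‖ * ‖v‖ = a := by field_simp
    rw [hwu] at h1 h2
    linarith
  have hle := hconv.leftDeriv_le_rightDeriv_of_mem_interior h0
  have hl := hconv.hasDerivWithinAt_leftDeriv_of_mem_interior h0
  have hr := hconv.hasDerivWithinAt_rightDeriv_of_mem_interior h0
  rw [key _ le_rfl hle] at hl
  rw [key _ hle le_rfl] at hr
  have h1 := (hasDerivWithinAt_Iio_iff_Iic.1 hl).union (hasDerivWithinAt_Ioi_iff_Ici.1 hr)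
  rw [Iic_union_Ici] at h1
  exact hasDerivWithinAt_univ.1 h1

end Conjugate

/-! ### Legendre functions, Bregman distances and moduli. -/

section Legendre

variable {E : Type*} [NormedAddCommGroup E] [NormedSpace ℝ E]

/-! ### Legendre functions -/

theorem IsLegendre.grad_mem_subdiff {f : E → EReal} (hf : IsGammaZero f) (hL : IsLegendre f)
    {x : E} (hx : x ∈ intDom f) : grad f x ∈ subdiff f x :=
  (hL.gateaux.hasGateauxDerivAt hx).mem_subdiff hf (intDom_subset_effDom hx)

theorem IsLegendre.domSubdiff_eq (hE : IsReflexiveSpace E) {f : E → EReal} (hf : IsGammaZero f)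
    (hL : IsLegendre f) : domSubdiff f = intDom f :=
  (hf.domSubdiff_subset_intDom hE hL.smooth.1).antisymm fun _ hx => ⟨_, hL.grad_mem_subdiff hf hx⟩

theorem IsLegendre.exists_nhds_le (hE : IsReflexiveSpace E) {f : E → EReal} (hf : IsGammaZero f)
    (hL : IsLegendre f) {x : E} (hx : x ∈ intDom f) :
    ∃ U ∈ 𝓝 x, ∃ M : ℝ, ∀ y ∈ U, y ∈ effDom f ∧ (f y).toReal ≤ M := by
  obtain ⟨r, hr, K, h⟩ := hf.exists_forall_ball_le hE hL.smooth.1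
    ⟨_, hL.grad_mem_subdiff hf hx⟩
  refine ⟨Metric.ball x r, Metric.ball_mem_nhds x hr, (f x).toReal + |K| * r, fun y hy =>
    ⟨(h y hy).1, (h y hy).2.trans ?_⟩⟩
  have h1 : ‖y - x‖ < r := by simpa [dist_eq_norm] using hy
  have h2 : K * ‖y - x‖ ≤ |K| * r :=
    mul_le_mul (le_abs_self K) h1.le (norm_nonneg _) (abs_nonneg K)
  linarith

/-- A subgradient `ξ` at `x` has `x ∈ ∂f*(ξ)`, and local boundedness of `∂f*` puts `dom ∂f*` inside
`int dom f*`. -/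
theorem IsLegendre.mem_intDom_conj (hE : IsReflexiveSpace E) {f : E → EReal} (hf : IsGammaZero f)
    (hL : IsLegendre f) {x : E} {ξ : StrongDual ℝ E} (hξ : ξ ∈ subdiff f x) :
    ξ ∈ intDom (conj f) :=
  (hf.conj ⟨ξ, (hf.conj_eq_of_mem_subdiff hξ).1⟩).domSubdiff_subset_intDom hE.dual hL.strict.1
    ⟨_, hf.inclusion_mem_subdiff_conj hξ⟩

theorem IsLegendre.lt_of_ne {f : E → EReal} (hf : IsGammaZero f) (hL : IsLegendre f) {C : Set E}
    (hC : C ⊆ domSubdiff f) (hCc : Convex ℝ C) {x y : E} (hx : x ∈ C) (hy : y ∈ C) (hxy : x ≠ y) :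
    (f ((1 / 2 : ℝ) • x + (1 / 2 : ℝ) • y)).toReal <
      1 / 2 * (f x).toReal + 1 / 2 * (f y).toReal := by
  have hd : ∀ w ∈ C, w ∈ effDom f := fun w hw => by
    obtain ⟨ξ, hξ⟩ := hC hw
    exact (hf.mem_subdiff_iff.1 hξ).1
  have h := hL.strict.2 C hC hCc x hx y hy hxy (1 / 2) (by norm_num) (by norm_num)
  have h1 : (1 - 1 / 2 : ℝ) = 1 / 2 := by norm_num
  rw [h1] at h
  have hm : (1 / 2 : ℝ) • x + (1 / 2 : ℝ) • y ∈ C :=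
    hCc hx hy (by norm_num) (by norm_num) (by norm_num)
  rw [← hf.coe_toReal (hd _ hm), ← hf.coe_toReal (hd x hx), ← hf.coe_toReal (hd y hy)] at h
  exact_mod_cast h

/-- The points having `ξ` as a subgradient form a convex subset of `dom ∂f` on which `f` is affine;
strict convexity leaves room for only one. -/
theorem IsLegendre.eq_of_mem_subdiff {f : E → EReal} (hf : IsGammaZero f) (hL : IsLegendre f)
    {x y : E} {ξ : StrongDual ℝ E} (hx : ξ ∈ subdiff f x) (hy : ξ ∈ subdiff f y) : x = y := by
  by_contra hxy
  have hC : {w | ξ ∈ subdiff f w} ⊆ domSubdiff f := fun w hw => ⟨ξ, hw⟩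
  have hCc : Convex ℝ {w | ξ ∈ subdiff f w} := by
    intro a ha b hb s t hs ht hst
    have ha' := hf.mem_subdiff_iff.1 ha
    have hb' := hf.mem_subdiff_iff.1 hb
    refine hf.mem_subdiff_iff.2 ⟨hf.convex_effDom ha'.1 hb'.1 hs ht hst, fun y hy => ?_⟩
    have h1 := hf.convexOn.2 ha'.1 hb'.1 hs ht hst
    have h2 := mul_le_mul_of_nonneg_left (ha'.2 y hy) hs
    have h3 := mul_le_mul_of_nonneg_left (hb'.2 y hy) ht
    simp only [smul_eq_mul, map_sub, map_add, map_smul] at h1 h2 h3 ⊢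
    have h4 : (f y).toReal = s * (f y).toReal + t * (f y).toReal := by rw [← add_mul, hst, one_mul]
    have h5 : ξ y = s * ξ y + t * ξ y := by rw [← add_mul, hst, one_mul]
    linarith
  have h1 := hL.lt_of_ne hf hC hCc hx hy hxy
  have hx' := hf.mem_subdiff_iff.1 hx
  have hy' := hf.mem_subdiff_iff.1 hy
  have hm := hf.convex_effDom hx'.1 hy'.1 (by norm_num : (0 : ℝ) ≤ 1 / 2)
    (by norm_num : (0 : ℝ) ≤ 1 / 2) (by norm_num)
  have h2 := hx'.2 _ hm
  have h3 := hy'.2 _ hm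
  simp only [map_sub, map_add, map_smul, smul_eq_mul] at h2 h3
  linarith

/-- The gradient of the conjugate of a Legendre function `f` at a subgradient of `f` at `x`
is `x`. -/
theorem IsLegendre.hasGateauxDerivAt_conj [CompleteSpace E] (hE : IsReflexiveSpace E)
    {f : E → EReal} (hf : IsGammaZero f) (hL : IsLegendre f) {x : E} {ξ : StrongDual ℝ E}
    (hξ : ξ ∈ subdiff f x) :
    HasGateauxDerivAt (conj f) (NormedSpace.inclusionInDoubleDual ℝ E x) ξ := by
  have hne : (effDom (conj f)).Nonempty := ⟨ξ, (hf.conj_eq_of_mem_subdiff hξ).1⟩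
  obtain ⟨r, hr, K, h⟩ := (hf.conj hne).exists_forall_ball_le hE.dual hL.strict.1
    ⟨_, hf.inclusion_mem_subdiff_conj hξ⟩
  refine (hf.conj hne).hasGateauxDerivAt_of_subdiff_subset (M := (conj f ξ).toReal + |K| * r) ?_
    (Metric.ball_mem_nhds ξ hr) fun ζ hζ => ⟨(h ζ hζ).1, (h ζ hζ).2.trans ?_⟩
  · intro F hF
    obtain ⟨y, rfl⟩ := hE F
    rw [hL.eq_of_mem_subdiff hf (hf.mem_subdiff_of_inclusion_mem hE hne hF) hξ]
    rfl
  · have h1 : ‖ζ - ξ‖ < r := by simpa [dist_eq_norm] using hζ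
    have h2 : K * ‖ζ - ξ‖ ≤ |K| * r :=
      mul_le_mul (le_abs_self K) h1.le (norm_nonneg _) (abs_nonneg K)
    linarith

/-- Equality in the monotonicity of `∇f` makes `∇f(x)` a subgradient at `y` as well. -/
theorem IsLegendre.eq_of_grad_sub_apply_eq_zero {f : E → EReal} (hf : IsGammaZero f)
    (hL : IsLegendre f) {x y : E} (hx : x ∈ intDom f) (hy : y ∈ intDom f)
    (h : grad f x (x - y) = grad f y (x - y)) : x = y := by
  have hx' := hL.grad_mem_subdiff hf hx
  refine hL.eq_of_mem_subdiff hf hx' (hf.mem_subdiff_iff.2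
    ⟨intDom_subset_effDom hy, fun w hw => ?_⟩)
  have h1 := (hf.mem_subdiff_iff.1 hx').2 w hw
  have h2 := (hf.mem_subdiff_iff.1 (hL.grad_mem_subdiff hf hy)).2 x (intDom_subset_effDom hx)
  simp only [map_sub] at *
  linarith

/-! ### Bregman distances -/

/-- The Bregman distance as a real number. -/
def realBregman (f : E → EReal) (x y : E) : ℝ :=
  (f x).toReal - (f y).toReal - grad f y (x - y)

theorem IsGammaZero.bregman_eq {f : E → EReal} (hf : IsGammaZero f) {x y : E} (hx : x ∈ effDom f)
    (hy : y ∈ intDom f) : bregman f x y = (realBregman f x y : EReal) := by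
  rw [bregman, if_pos hy, realBregman, EReal.coe_sub, EReal.coe_sub, hf.coe_toReal hx,
    hf.coe_toReal (intDom_subset_effDom hy)]

theorem IsGammaZero.mem_effDom_of_bregman_lt_top {f : E → EReal} (hf : IsGammaZero f) {x y : E}
    (h : bregman f x y < ⊤) : x ∈ effDom f ∧ y ∈ intDom f := by
  have hy : y ∈ intDom f := by
    by_contra hy
    rw [bregman, if_neg hy] at h
    exact lt_irrefl _ h
  refine ⟨?_, hy⟩
  by_contra hx
  have hx' : f x = ⊤ := by simpa [effDom] using hx
  rw [bregman, if_pos hy, hx', ← hf.coe_toReal (intDom_subset_effDom hy), EReal.top_sub_coe,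
    EReal.top_sub_coe] at h
  exact lt_irrefl _ h

theorem realBregman_nonneg {f : E → EReal} (hf : IsGammaZero f) (hd : GateauxOnIntDom f) {x y : E}
    (hx : x ∈ effDom f) (hy : y ∈ intDom f) : 0 ≤ realBregman f x y := by
  have h := (hf.mem_subdiff_iff.1 ((hd.hasGateauxDerivAt hy).mem_subdiff hf
    (intDom_subset_effDom hy))).2 x hx
  rw [realBregman]
  linarith

theorem realBregman_self (f : E → EReal) (x : E) : realBregman f x x = 0 := by
  simp [realBregman]

theorem realBregman_combo_le {f : E → EReal} (hf : IsGammaZero f) {x z y : E}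
    (hx : x ∈ effDom f) (hz : z ∈ effDom f) {t : ℝ} (h0 : 0 ≤ t) (h1 : t ≤ 1) :
    realBregman f (t • x + (1 - t) • z) y ≤
      t * realBregman f x y + (1 - t) * realBregman f z y := by
  have h := (hf.mem_effDom_and_toReal_le hx hz h0 h1).2
  simp only [realBregman, map_sub, map_add, map_smul, smul_eq_mul]
  linarith

/-- Sequential consistency, uniformly along a bounded sequence. -/
theorem BregmanSeqConsistent.exists_forall_norm_lt {f : E → EReal} (hf : IsGammaZero f)
    (hd : GateauxOnIntDom f) (hcons : BregmanSeqConsistent f) {u : ℕ → E}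
    (hu : ∀ n, u n ∈ intDom f) (hb : Bornology.IsBounded (range u)) {δ : ℝ} (hδ : 0 < δ) :
    ∃ ρ > 0, ∀ n, ∀ w ∈ intDom f, realBregman f w (u n) < ρ → ‖w - u n‖ < δ := by
  by_contra hcon
  push Not at hcon
  choose n w hw hwρ hwδ using fun j : ℕ => hcon (1 / ((j : ℝ) + 1)) (by positivity)
  obtain ⟨R, hR⟩ := isBounded_iff_forall_norm_le.1 hb
  -- The points `w j` may be unbounded, so they are pulled along the segment to distance exactly `δ`
  -- from `u (n j)`. Convexity of the Bregman distance in its first argument keeps it small there,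
  -- and sequential consistency applies.
  set s : ℕ → ℝ := fun j => δ / ‖w j - u (n j)‖ with hs
  have hpos : ∀ j, 0 < ‖w j - u (n j)‖ := fun j => hδ.trans_le (hwδ j)
  have hs0 : ∀ j, 0 < s j := fun j => div_pos hδ (hpos j)
  have hs1 : ∀ j, s j ≤ 1 := fun j => (div_le_one (hpos j)).2 (hwδ j)
  set v : ℕ → E := fun j => s j • w j + (1 - s j) • u (n j) with hv
  have hvsub : ∀ j, v j - u (n j) = s j • (w j - u (n j)) := fun j => by
    simp only [hv]
    module
  have hvnorm : ∀ j, ‖v j - u (n j)‖ = δ := fun j => by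
    rw [hvsub, norm_smul, Real.norm_eq_abs, abs_of_pos (hs0 j)]
    exact div_mul_cancel₀ δ (hpos j).ne'
  have hvint : ∀ j, v j ∈ intDom f := fun j =>
    hf.convex_intDom (hw j) (hu _) (hs0 j).le (sub_nonneg.2 (hs1 j)) (by ring)
  have hvle : ∀ j : ℕ, realBregman f (v j) (u (n j)) ≤ 1 / ((j : ℝ) + 1) := fun j => by
    have h1 := realBregman_combo_le hf (y := u (n j)) (intDom_subset_effDom (hw j))
      (intDom_subset_effDom (hu (n j))) (hs0 j).le (hs1 j)
    rw [realBregman_self, mul_zero, add_zero] at h1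
    have h2 := realBregman_nonneg hf hd (intDom_subset_effDom (hw j)) (hu (n j))
    exact h1.trans ((mul_le_of_le_one_left h2 (hs1 j)).trans (hwρ j).le)
  have hlim := hcons v (fun j => u (n j)) hvint (fun j => hu _)
    (isBounded_iff_forall_norm_le.2 ⟨δ + R, by
      rintro _ ⟨j, rfl⟩
      have h1 : ‖v j‖ ≤ ‖v j - u (n j)‖ + ‖u (n j)‖ := by
        simpa using norm_add_le (v j - u (n j)) (u (n j))
      rw [hvnorm] at h1
      linarith [hR _ (mem_range_self (n j))]⟩)
    (hb.subset (by rintro _ ⟨j, rfl⟩; exact mem_range_self _)) (by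
      have h1 : (fun j => bregman f (v j) (u (n j)))
          = fun j => ((realBregman f (v j) (u (n j)) : ℝ) : EReal) := by
        funext j
        exact hf.bregman_eq (intDom_subset_effDom (hvint j)) (hu _)
      rw [h1, ← EReal.coe_zero, EReal.tendsto_coe]
      exact squeeze_zero
        (fun j => realBregman_nonneg hf hd (intDom_subset_effDom (hvint j)) (hu _)) hvle
        tendsto_one_div_add_atTop_nhds_zero_nat)
  have h2 := hlim.norm
  simp only [hvnorm, norm_zero] at h2
  exact hδ.ne' (tendsto_nhds_unique tendsto_const_nhds h2)

/-! ### Uniform convexity at a point -/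

/-- The midpoint gap dominates `ϕ(‖x - y n‖) / 4`, so `ϕ(‖x - y n‖) → 0`; since `ϕ` is increasing
and `ϕ(δ) > 0`, the norm is eventually below `δ`. -/
theorem UniformlyConvexAt.tendsto_of_midpoint {g : E → EReal} (hg : IsGammaZero g) {x : E}
    (h : UniformlyConvexAt g x) {y : ℕ → E} (hy : ∀ n, y n ∈ effDom g) {b : ℕ → ℝ}
    (hb : Tendsto b atTop (𝓝 0))
    (hle : ∀ n, 1 / 2 * (g x).toReal + 1 / 2 * (g (y n)).toReal -
      (g ((1 / 2 : ℝ) • x + (1 / 2 : ℝ) • y n)).toReal ≤ b n) :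
    Tendsto y atTop (𝓝 x) := by
  obtain ⟨hx, ϕ, hmono, hzero, hϕ⟩ := h
  have key : ∀ n, ϕ ‖x - y n‖₊ ≤ ENNReal.ofReal (4 * b n) := by
    intro n
    have h1 := hϕ (y n) (hy n) (1 / 2) (by norm_num) (by norm_num)
    have h2 : (1 - 1 / 2 : ℝ) = 1 / 2 := by norm_num
    rw [h2] at h1
    have hm : (1 / 2 : ℝ) • x + (1 / 2 : ℝ) • y n ∈ effDom g :=
      hg.convex_effDom hx (hy n) (by norm_num) (by norm_num) (by norm_num)
    rw [← hg.coe_toReal hm, ← hg.coe_toReal hx, ← hg.coe_toReal (hy n)] at h1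
    have h3 := hle n
    set p := ϕ ‖x - y n‖₊ with hp
    by_cases hpt : p = ⊤
    · rw [hpt, EReal.coe_ennreal_top, EReal.coe_mul_top_of_pos (by norm_num), EReal.coe_add_top,
        ← EReal.coe_mul, ← EReal.coe_mul, ← EReal.coe_add] at h1
      exact absurd (top_le_iff.1 h1) (EReal.coe_ne_top _)
    · rw [← EReal.coe_ennreal_toReal hpt, ← EReal.coe_mul, ← EReal.coe_add, ← EReal.coe_mul,
        ← EReal.coe_mul, ← EReal.coe_add, EReal.coe_le_coe_iff] at h1
      rw [← ENNReal.ofReal_toReal hpt]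
      refine ENNReal.ofReal_le_ofReal ?_
      linarith
  have hlim : Tendsto (fun n => ENNReal.ofReal (4 * b n)) atTop (𝓝 0) := by
    have := ENNReal.tendsto_ofReal (hb.const_mul 4)
    simpa using this
  rw [Metric.tendsto_atTop]
  intro δ hδ
  have hϕδ : 0 < ϕ δ.toNNReal := by
    rw [pos_iff_ne_zero, Ne, hzero]
    exact (Real.toNNReal_pos.2 hδ).ne'
  obtain ⟨N, hN⟩ := eventually_atTop.1 (hlim.eventually (gt_mem_nhds hϕδ))
  refine ⟨N, fun n hn => ?_⟩
  rw [dist_comm, dist_eq_norm]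
  by_contra hcon
  push Not at hcon
  have h1 : δ.toNNReal ≤ ‖x - y n‖₊ := Real.toNNReal_le_iff_le_coe.2 hcon
  exact absurd ((hmono h1).trans (key n)) (not_le.2 (hN n hn))

end Legendre

section Step

variable {X Y : Type*} [NormedAddCommGroup X] [NormedSpace ℝ X]
  [NormedAddCommGroup Y] [NormedSpace ℝ Y]

/-! ### Proximity operators and the forward-backward step -/

/-- The minorant `u + c` of `φ` bounds the objective below by `f - (ζ - γ u)` plus a constant, whose
sublevel sets are bounded because `ζ - γ u ∈ int dom f*`; this gives existence. The sum rule puts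
minimizers in `dom ∂f = int dom f`, where strict convexity gives uniqueness. -/
theorem proxOp_scale_eq_singleton (hX : IsReflexiveSpace X) {φ : X → EReal} (hφ : IsGammaZero φ)
    {f : X → EReal} (hf : IsGammaZero f) (hL : IsLegendre f) {γ : ℝ} (hγ : 0 < γ) {z : X}
    (hz : z ∈ effDom φ) (hzf : z ∈ intDom f) {ζ u : StrongDual ℝ X} {c : ℝ}
    (hu : ∀ w ∈ effDom φ, u w + c ≤ (φ w).toReal) (hζ : ζ - γ • u ∈ intDom (conj f)) :
    ∃ p ∈ intDom f, p ∈ effDom φ ∧ proxOp f (scale γ φ) ζ = {p} ∧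
      ∀ w ∈ effDom φ, (ζ - grad f p) (w - p) + γ * (φ p).toReal ≤ γ * (φ w).toReal := by
  have hzf' := intDom_subset_effDom hzf
  have hφγ := hφ.scale hγ
  have hdγ : effDom (scale γ φ) = effDom φ := effDom_scale hγ
  have hsum : IsGammaZero fun x => scale γ φ x + f x := hφγ.add hf ⟨z, by rwa [hdγ], hzf'⟩
  have hsd : effDom (fun x => scale γ φ x + f x) = effDom φ ∩ effDom f := by
    rw [hφγ.effDom_add hf, hdγ]
  obtain ⟨hF, hFd, -⟩ := hsum.sub_clm ζ
  rw [hsd] at hFd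
  have hval : ∀ x ∈ effDom φ, x ∈ effDom f → scale γ φ x + f x - ((ζ x : ℝ) : EReal)
      = ((γ * (φ x).toReal + (f x).toReal - ζ x : ℝ) : EReal) := by
    intro x hx hxf
    have hx' : x ∈ effDom (scale γ φ) := by rwa [hdγ]
    rw [EReal.coe_sub, EReal.coe_add, ← toReal_scale, hφγ.coe_toReal hx', hf.coe_toReal hxf]
  have hdom_of_le : ∀ x, ∀ r : ℝ, scale γ φ x + f x - ((ζ x : ℝ) : EReal) ≤ r →
      x ∈ effDom φ ∧ x ∈ effDom f := fun x r h => by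
    have h1 : x ∈ effDom fun x => scale γ φ x + f x - ((ζ x : ℝ) : EReal) := mem_effDom_of_le_coe h
    rwa [hFd] at h1
  have hprops : ∀ p ∈ proxOp f (scale γ φ) ζ, p ∈ intDom f ∧ p ∈ effDom φ ∧
      (∀ w ∈ effDom φ, w ∈ effDom f →
        γ * (φ p).toReal + (f p).toReal - ζ p ≤ γ * (φ w).toReal + (f w).toReal - ζ w) ∧
      ∀ w ∈ effDom φ, (ζ - grad f p) (w - p) + γ * (φ p).toReal ≤ γ * (φ w).toReal := by
    intro p hp
    have hpz := hp.2 z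
    rw [hval z hz hzf'] at hpz
    obtain ⟨hpφ, hpf⟩ := hdom_of_le p _ hpz
    have hmin : ∀ w ∈ effDom φ, w ∈ effDom f →
        γ * (φ p).toReal + (f p).toReal - ζ p ≤ γ * (φ w).toReal + (f w).toReal - ζ w := by
      intro w hw hwf
      have := hp.2 w
      rwa [hval w hw hwf, hval p hpφ hpf, EReal.coe_le_coe_iff] at this
    -- The sum rule is applied to `γ φ` and `f - ζ`. Intersecting `U` with a half-space bounds `f -
    -- ζ` above by `M - (ζ z - 1)` near `z`.
    obtain ⟨U, hU, M, hM⟩ := hL.exists_nhds_le hX hf hzf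
    obtain ⟨v, hv1, hv2⟩ := exists_subgradient_of_isMin (hφ.convexOn.smul hγ.le)
      (hf.convexOn.sub (ζ.toLinearMap.concaveOn hf.convex_effDom)) hpφ hpf
      (fun w hw hwf => by
        have := hmin w hw hwf
        simp only [smul_eq_mul, Pi.sub_apply, ContinuousLinearMap.coe_coe]
        linarith) hz (U := U ∩ {y | ζ z - 1 < ζ y})
      (inter_mem hU ((isOpen_lt continuous_const ζ.continuous).mem_nhds (by simp)))
      (fun y hy => (hM y hy.1).1) (M := M - (ζ z - 1)) (fun y hy => by
        have h1 := (hM y hy.1).2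
        have h2 : ζ z - 1 < ζ y := hy.2
        simp only [Pi.sub_apply, ContinuousLinearMap.coe_coe]
        linarith)
    simp only [smul_eq_mul, Pi.sub_apply, ContinuousLinearMap.coe_coe] at hv1 hv2
    have hvf : v + ζ ∈ subdiff f p := hf.mem_subdiff_iff.2 ⟨hpf, fun w hw => by
      have := hv1 w hw
      simp only [add_apply, map_sub] at this ⊢
      linarith⟩
    have hpint : p ∈ intDom f := hL.domSubdiff_eq hX hf ▸ ⟨_, hvf⟩
    have hgrad := (hL.gateaux.hasGateauxDerivAt hpint).eq_of_mem_subdiff hf hpint hvf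
    refine ⟨hpint, hpφ, hmin, fun w hw => ?_⟩
    have h1 := hv2 w hw
    rw [← hgrad, sub_add_cancel_right, neg_apply]
    exact h1
  obtain ⟨p, hp⟩ := hX.exists_isMin hF.convex_sublevel hF.isClosed_sublevel (z := z) (by
    refine (hf.isBounded_sublevel_sub hζ
      (γ * (φ z).toReal + (f z).toReal - ζ z - γ * c)).subset fun x hx => ?_
    have h1 : scale γ φ x + f x - ((ζ x : ℝ) : EReal) ≤ scale γ φ z + f z - ((ζ z : ℝ) : EReal) :=
      hx
    rw [hval z hz hzf'] at h1
    obtain ⟨hxφ, hxf⟩ := hdom_of_le x _ h1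
    rw [hval x hxφ hxf, EReal.coe_le_coe_iff] at h1
    have h2 := mul_le_mul_of_nonneg_left (hu x hxφ) hγ.le
    refine ⟨hxf, ?_⟩
    simp only [sub_apply, smul_apply, smul_eq_mul]
    linarith)
  have hpprox : p ∈ proxOp f (scale γ φ) ζ := by
    refine ⟨lt_of_le_of_lt (hp z) ?_, hp⟩
    rw [hval z hz hzf']
    exact EReal.coe_lt_top _
  obtain ⟨hpf, hpφ, hpmin, hpsub⟩ := hprops p hpprox
  refine ⟨p, hpf, hpφ, eq_singleton_iff_unique_mem.2 ⟨hpprox, fun q hq => ?_⟩, hpsub⟩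
  obtain ⟨hqf, hqφ, hqmin, -⟩ := hprops q hq
  by_contra hqp
  have h1 := hL.lt_of_ne hf (hL.domSubdiff_eq hX hf).ge hf.convex_intDom hqf hpf hqp
  have h0 : (0 : ℝ) ≤ 1 / 2 := by norm_num
  have h01 : (1 / 2 + 1 / 2 : ℝ) = 1 := by norm_num
  have h2 := hφ.convexOn.2 hqφ hpφ h0 h0 h01
  have hmφ := hφ.convex_effDom hqφ hpφ h0 h0 h01
  have hmf := hf.convex_effDom (intDom_subset_effDom hqf) (intDom_subset_effDom hpf) h0 h0 h01
  have h3 := hpmin _ hmφ hmf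
  have h4 := hqmin _ hmφ hmf
  have h5 := mul_le_mul_of_nonneg_left h2 hγ.le
  simp only [smul_eq_mul, map_add, map_smul] at h3 h4 h5
  linarith

theorem HasGateauxDerivAt.comp_clm {ψ : Y → EReal} {L : X →L[ℝ] Y} {x : X}
    {ξ : StrongDual ℝ Y} (h : HasGateauxDerivAt ψ ξ (L x)) :
    HasGateauxDerivAt (fun x => ψ (L x)) (adj L ξ) x := by
  intro v
  have h1 : HasDerivAt (fun t : ℝ => (ψ (L x + t • L v)).toReal) (ξ (L v)) 0 := h (L v)
  have h2 : HasDerivAt (fun t : ℝ => (ψ (L (x + t • v))).toReal) (ξ (L v)) 0 := by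
    simpa only [map_add, map_smul] using h1
  exact h2

theorem HasGateauxDerivAt.scale {f : X → EReal} {x : X} {ξ : StrongDual ℝ X}
    (h : HasGateauxDerivAt f ξ x) (β : ℝ) : HasGateauxDerivAt (scale β f) (β • ξ) x := by
  intro v
  have h1 : HasDerivAt (fun t : ℝ => (f (x + t • v)).toReal) (ξ v) 0 := h v
  have h2 : HasDerivAt (fun t : ℝ => (BregmanFB.scale β f (x + t • v)).toReal) (β * ξ v) 0 := by
    simpa only [toReal_scale] using h1.const_mul β
  exact h2

/-- Finiteness of `D^f(x, y)` forces `L x ∈ dom ψ` even when `x` is a boundary point of `dom f`,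
where the inclusion of interiors says nothing. -/
theorem Dominates.mul_realBregman_le {f : X → EReal} {ψ : Y → EReal} {L : X →L[ℝ] Y} {β : ℝ}
    (hdom : Dominates f f (scale β fun x => ψ (L x))) (hβ : 0 < β) (hf : IsGammaZero f)
    (hψ : IsGammaZero ψ) (hψd : GateauxOnIntDom ψ) (hL : ∀ x ∈ intDom f, L x ∈ intDom ψ)
    {x y : X} (hx : x ∈ effDom f) (hy : y ∈ intDom f) :
    L x ∈ effDom ψ ∧ β * realBregman ψ (L x) (L y) ≤ realBregman f x y := by
  have h := hdom x hx y hy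
  rw [hf.bregman_eq hx hy] at h
  have hG : IsGammaZero (scale β fun x => ψ (L x)) :=
    (hψ.comp L ⟨y, intDom_subset_effDom (hL y hy)⟩).scale hβ
  have hd : effDom (scale β fun x => ψ (L x)) = L ⁻¹' effDom ψ := by
    rw [effDom_scale hβ]
    rfl
  have hlt := lt_of_le_of_lt h (EReal.coe_lt_top _)
  obtain ⟨h1, h2⟩ := hG.mem_effDom_of_bregman_lt_top hlt
  rw [hG.bregman_eq h1 h2, EReal.coe_le_coe_iff] at h
  rw [hd] at h1
  refine ⟨h1, le_of_eq_of_le ?_ h⟩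
  rw [realBregman, realBregman, ((hψd.hasGateauxDerivAt (hL y hy)).comp_clm.scale β).grad_eq,
    toReal_scale, toReal_scale, smul_apply, smul_eq_mul, adj, ContinuousLinearMap.comp_apply,
    map_sub L]
  ring

/-- The decrease of the Bregman distance to a point in a forward-backward step. -/
theorem realBregman_step_le {f φ : X → EReal} {ψ : Y → EReal} {L : X →L[ℝ] Y} {β γ : ℝ}
    (hdom : Dominates f f (scale β fun x => ψ (L x))) (hβ : 0 < β) (hf : IsGammaZero f)
    (hψ : IsGammaZero ψ) (hψd : GateauxOnIntDom ψ)
    (hL : ∀ x ∈ intDom f, L x ∈ intDom ψ) (hγ : 0 < γ) (hγβ : γ ≤ β) {x p z : X}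
    (hx : x ∈ intDom f) (hp : p ∈ intDom f)
    (hstep : ∀ w ∈ effDom φ, (grad f x - γ • adj L (grad ψ (L x)) - grad f p) (w - p) +
      γ * (φ p).toReal ≤ γ * (φ w).toReal)
    (hz : z ∈ effDom φ) (hzf : z ∈ effDom f) :
    realBregman f z p + γ * ((φ p).toReal + (ψ (L p)).toReal -
      ((φ z).toReal + (ψ (L z)).toReal)) ≤ realBregman f z x := by
  -- Expanding the Bregman distances leaves on the right `D^f(z, x) - D^f(p, x) + γ D^ψ(Lp, Lx) - γ
  -- D^ψ(Lz, Lx)`; the two middle terms add up to at most `0` since `γ ≤ β`.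
  have h1 := hstep z hz
  have hpf := intDom_subset_effDom hp
  have h2 := (hdom.mul_realBregman_le hβ hf hψ hψd hL hpf hx).2
  have h3 := realBregman_nonneg hψ hψd (intDom_subset_effDom (hL p hp)) (hL x hx)
  have h4 := realBregman_nonneg hψ hψd (hdom.mul_realBregman_le hβ hf hψ hψd hL hzf hx).1 (hL x hx)
  have h5 := mul_le_mul_of_nonneg_right hγβ h3
  have h6 := mul_nonneg hγ.le h4
  simp only [realBregman, sub_apply, smul_apply, smul_eq_mul, adj,
    ContinuousLinearMap.comp_apply, map_sub] at *
  linarith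

end Step

section Minimizing

variable {E : Type*} [NormedAddCommGroup E] [NormedSpace ℝ E]

/-! ### Minimizing sequences that are monotone with respect to Bregman distances -/

/-- The points at which `G` is finite and minimal. -/
def minimizers (G : E → EReal) : Set E :=
  {x | G x < ⊤ ∧ ∀ z, G x ≤ G z}

theorem minimizers_subset_effDom {G : E → EReal} : minimizers G ⊆ effDom G := fun _ hx => hx.1

theorem toReal_le_of_mem_minimizers {G : E → EReal} (hG : IsGammaZero G) {z w : E}
    (hz : z ∈ minimizers G) (hw : w ∈ effDom G) : (G z).toReal ≤ (G w).toReal :=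
  EReal.toReal_le_toReal (hz.2 w) (hG.ne_bot z) (ne_of_lt hw)

theorem mem_minimizers_of_le {G : E → EReal} {z w : E} (hz : z ∈ minimizers G)
    (hw : G w ≤ G z) : w ∈ minimizers G :=
  ⟨lt_of_le_of_lt hw hz.1, fun v => hw.trans (hz.2 v)⟩

theorem convex_minimizers {G : E → EReal} (hG : IsGammaZero G) : Convex ℝ (minimizers G) := by
  intro a ha b hb s t hs ht hst
  exact mem_minimizers_of_le ha
    (hG.convex_sublevel (G a) (le_refl (G a)) (hb.2 a) hs ht hst)

/-- A sequence in `int dom f` along which `G` decreases to its minimum at a rate controlled by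
the decrease of the Bregman distances to the minimizers of `G`. -/
structure BregmanMinimizing (f G : E → EReal) (ε : ℝ) (x : ℕ → E) : Prop where
  mem_intDom : ∀ n, x n ∈ intDom f
  -- The index starts at `1`: the starting point need not lie in `dom G`.
  mem_effDom : ∀ n, x (n + 1) ∈ effDom G
  decrease : ∀ z ∈ minimizers G, z ∈ effDom f → ∀ n,
    realBregman f z (x (n + 1)) + ε * ((G (x (n + 1))).toReal - (G z).toReal) ≤
      realBregman f z (x n)

namespace BregmanMinimizing

variable {f G : E → EReal} {ε : ℝ} {x : ℕ → E} {z₀ : E}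

theorem antitone (h : BregmanMinimizing f G ε x) (hε : 0 < ε) (hG : IsGammaZero G) {z : E}
    (hz : z ∈ minimizers G) (hzf : z ∈ effDom f) : Antitone fun n => realBregman f z (x n) := by
  refine antitone_nat_of_succ_le fun n => ?_
  have h1 := h.decrease z hz hzf n
  have h2 := toReal_le_of_mem_minimizers hG hz (h.mem_effDom n)
  nlinarith

theorem tendsto_realBregman (h : BregmanMinimizing f G ε x) (hε : 0 < ε) (hG : IsGammaZero G)
    (hf : IsGammaZero f) (hd : GateauxOnIntDom f) {z : E} (hz : z ∈ minimizers G)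
    (hzf : z ∈ effDom f) : ∃ a, Tendsto (fun n => realBregman f z (x n)) atTop (𝓝 a) :=
  ⟨_, tendsto_atTop_ciInf (h.antitone hε hG hz hzf) ⟨0, by
    rintro _ ⟨n, rfl⟩
    exact realBregman_nonneg hf hd hzf (h.mem_intDom n)⟩⟩

theorem isBounded (h : BregmanMinimizing f G ε x) (hε : 0 < ε) (hG : IsGammaZero G)
    (hf : IsGammaZero f) (hz : z₀ ∈ minimizers G) (hzf : z₀ ∈ intDom f)
    (hcoer : Coercive fun y => bregman f z₀ y) : Bornology.IsBounded (range x) := by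
  have h1 : ∀ᶠ y in Bornology.cobounded E,
      ((realBregman f z₀ (x 0) : ℝ) : EReal) < bregman f z₀ y :=
    hcoer.eventually (lt_mem_nhds (EReal.coe_lt_top _))
  have h2 : Bornology.IsBounded
      {y | ((realBregman f z₀ (x 0) : ℝ) : EReal) < bregman f z₀ y}ᶜ := by
    rw [Bornology.isBounded_def, compl_compl]
    exact h1
  refine h2.subset ?_
  rintro _ ⟨n, rfl⟩
  have h3 := h.antitone hε hG hz (intDom_subset_effDom hzf) (Nat.zero_le n)
  simp only [mem_compl_iff, mem_ofPred_eq, not_lt]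
  rw [hf.bregman_eq (intDom_subset_effDom hzf) (h.mem_intDom n)]
  exact_mod_cast h3

/-- The gap is at most `1 / ε` times a consecutive difference of the convergent sequence `D^f(z₀, x
n)`. -/
theorem tendsto_value (h : BregmanMinimizing f G ε x) (hε : 0 < ε) (hG : IsGammaZero G)
    (hf : IsGammaZero f) (hd : GateauxOnIntDom f) (hz : z₀ ∈ minimizers G)
    (hzf : z₀ ∈ effDom f) :
    Tendsto (fun n => (G (x (n + 1))).toReal - (G z₀).toReal) atTop (𝓝 0) := by
  obtain ⟨a, ha⟩ := h.tendsto_realBregman hε hG hf hd hz hzf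
  have h1 : Tendsto (fun n => (realBregman f z₀ (x n) - realBregman f z₀ (x (n + 1))) / ε) atTop
      (𝓝 0) := by
    have := (ha.sub (ha.comp (tendsto_add_atTop_nat 1))).div_const ε
    simpa using this
  refine squeeze_zero (fun n => sub_nonneg.2 (toReal_le_of_mem_minimizers hG hz (h.mem_effDom n)))
    (fun n => ?_) h1
  rw [le_div_iff₀ hε]
  linarith [h.decrease z₀ hz hzf n]

theorem mem_minimizers (h : BregmanMinimizing f G ε x) (hε : 0 < ε) (hG : IsGammaZero G)
    (hf : IsGammaZero f) (hd : GateauxOnIntDom f) (hz : z₀ ∈ minimizers G)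
    (hzf : z₀ ∈ effDom f) {k : ℕ → ℕ} (hk : Tendsto k atTop atTop) {l : E}
    (hl : WeakTendsto (x ∘ k) l) : l ∈ minimizers G := by
  refine mem_minimizers_of_le hz ?_
  rw [← hG.coe_toReal (minimizers_subset_effDom hz)]
  refine EReal.le_of_forall_lt_iff_le.1 fun c hc => ?_
  rw [EReal.coe_lt_coe_iff] at hc
  refine hl.mem_of_isClosed_of_convex (hG.convex_sublevel c) (hG.isClosed_sublevel c) ?_
  have h1 : ∀ᶠ n in atTop, G (x n) ≤ c := by
    rw [← map_add_atTop_eq_nat 1, eventually_map]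
    filter_upwards [(h.tendsto_value hε hG hf hd hz hzf).eventually
      (gt_mem_nhds (sub_pos.2 hc))] with n hn
    exact hG.le_coe_iff.2 ⟨h.mem_effDom n, by linarith⟩
  exact hk.eventually h1

theorem mem_closure (h : BregmanMinimizing f G ε x) (hf : IsGammaZero f) {k : ℕ → ℕ} {l : E}
    (hl : WeakTendsto (x ∘ k) l) : l ∈ closure (effDom f) :=
  hl.mem_of_isClosed_of_convex hf.convex_effDom.closure isClosed_closure
    (Eventually.of_forall fun _ => subset_closure (intDom_subset_effDom (h.mem_intDom _)))

/-- Opial's argument: `D^f(l, x n) - D^f(l', x n)` converges along the whole sequence, and up to a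
constant it is `-∇f(x n)(l - l')`. Passing to the limit along both subsequences gives `∇f(l)(l - l')
= ∇f(l')(l - l')`. -/
theorem weak_limit_unique (h : BregmanMinimizing f G ε x) (hε : 0 < ε) (hG : IsGammaZero G)
    (hf : IsGammaZero f) (hL : IsLegendre f) (hw : GradWeakSeqContinuous f) {l l' : E}
    (hl : l ∈ minimizers G) (hlf : l ∈ intDom f) (hl' : l' ∈ minimizers G) (hlf' : l' ∈ intDom f)
    {k k' : ℕ → ℕ} (hk : Tendsto k atTop atTop) (hk' : Tendsto k' atTop atTop)
    (hxl : WeakTendsto (x ∘ k) l) (hxl' : WeakTendsto (x ∘ k') l') : l = l' := by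
  obtain ⟨a, ha⟩ := h.tendsto_realBregman hε hG hf hL.gateaux hl (intDom_subset_effDom hlf)
  obtain ⟨b, hb⟩ := h.tendsto_realBregman hε hG hf hL.gateaux hl' (intDom_subset_effDom hlf')
  have h1 : Tendsto (fun n => grad f (x n) (l - l')) atTop
      (𝓝 ((f l).toReal - (f l').toReal - (a - b))) := by
    refine ((ha.sub hb).const_sub ((f l).toReal - (f l').toReal)).congr fun n => ?_
    simp only [realBregman, map_sub]
    ring
  have h2 : ∀ {m : E} {j : ℕ → ℕ}, m ∈ intDom f → Tendsto j atTop atTop → WeakTendsto (x ∘ j) m →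
      grad f m (l - l') = (f l).toReal - (f l').toReal - (a - b) := by
    intro m j hm hj hxm
    have h3 := weakTendsto_iff.1 (hw _ m (fun n => h.mem_intDom (j n)) hm hxm)
      (NormedSpace.inclusionInDoubleDual ℝ E (l - l'))
    exact tendsto_nhds_unique h3 (h1.comp hj)
  exact hL.eq_of_grad_sub_apply_eq_zero hf hlf hlf' ((h2 hlf hk hxl).trans (h2 hlf' hk' hxl').symm)

/-- The gradients `ξ n` satisfy `f*(ξ n) - ⟨z₀, ξ n⟩ = D^f(z₀, x (k n)) - f z₀`, bounded above, so
they are bounded because `z₀ ∈ int dom f`. A weak cluster point `ζ` lies in `dom f*`, which is open,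
so `ζ ∈ ∂f(y)` for some `y`. Weak continuity of `∇f*`, which sends `ξ n` back to `x (k n)`, gives `l
= y ∈ dom ∂f`. -/
theorem mem_intDom_of_weakTendsto [CompleteSpace E] (hE : IsReflexiveSpace E)
    (h : BregmanMinimizing f G ε x) (hε : 0 < ε) (hG : IsGammaZero G)
    (hf : IsGammaZero f) (hL : IsLegendre f) (hz : z₀ ∈ minimizers G) (hzf : z₀ ∈ intDom f)
    (hopen : IsOpen (effDom (conj f))) (hw : GradWeakSeqContinuous (conj f)) {k : ℕ → ℕ} {l : E}
    (hl : WeakTendsto (x ∘ k) l) : l ∈ intDom f := by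
  set ξ : ℕ → StrongDual ℝ E := fun n => grad f (x (k n)) with hξ
  have hξs : ∀ n, ξ n ∈ subdiff f (x (k n)) := fun n => hL.grad_mem_subdiff hf (h.mem_intDom _)
  have hξd : ∀ n, ξ n ∈ effDom (conj f) := fun n => (hf.conj_eq_of_mem_subdiff (hξs n)).1
  have hint : intDom (conj f) = effDom (conj f) := hopen.interior_eq
  have hbd : ∀ n, (conj f (ξ n)).toReal - ξ n z₀ ≤ realBregman f z₀ (x 0) - (f z₀).toReal := by
    intro n
    have h1 := h.antitone hε hG hz (intDom_subset_effDom hzf) (Nat.zero_le (k n))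
    rw [(hf.conj_eq_of_mem_subdiff (hξs n)).2]
    simp only [realBregman, map_sub] at h1 ⊢
    linarith
  have hb : Bornology.IsBounded (range ξ) :=
    (hf.isBounded_sublevel_conj_sub hzf _).subset (by
      rintro _ ⟨n, rfl⟩
      exact ⟨hξd n, hbd n⟩)
  obtain ⟨R, hR⟩ := isBounded_iff_forall_norm_le.1 hb
  obtain ⟨ζ, j, hj, hζ⟩ := hE.dual.exists_weakTendsto_subseq hb
  have hconj : IsGammaZero (conj f) := hf.conj ⟨_, hξd 0⟩
  have hζd : ζ ∈ effDom (conj f) := by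
    refine mem_effDom_of_le_coe (c := realBregman f z₀ (x 0) - (f z₀).toReal + R * ‖z₀‖) ?_
    refine hζ.mem_of_isClosed_of_convex (hconj.convex_sublevel _) (hconj.isClosed_sublevel _)
      (Eventually.of_forall fun n => ?_)
    refine hconj.le_coe_iff.2 ⟨hξd _, ?_⟩
    have h1 := hbd (j n)
    have h2 : ξ (j n) z₀ ≤ R * ‖z₀‖ := (le_abs_self _).trans
      ((ξ (j n)).le_of_opNorm_le (hR _ (mem_range_self _)) z₀)
    simp only [Function.comp_apply]
    linarith
  obtain ⟨y, hy⟩ := hf.exists_mem_subdiff_of_mem_intDom_conj hE (hint ▸ hζd)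
  have h1 := hw _ ζ (fun n => hint ▸ hξd (j n)) (hint ▸ hζd) hζ
  rw [(hL.hasGateauxDerivAt_conj hE hf hy).grad_eq] at h1
  have h2 : WeakTendsto (x ∘ k ∘ j) y := by
    rw [weakTendsto_iff]
    intro v
    have h3 := weakTendsto_iff.1 h1 (NormedSpace.inclusionInDoubleDual ℝ (StrongDual ℝ E) v)
    refine h3.congr fun n => ?_
    rw [Function.comp_apply, (hL.hasGateauxDerivAt_conj hE hf (hξs (j n))).grad_eq]
    rfl
  have h4 : y = l := h2.unique (hl.comp hj.tendsto_atTop)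
  subst h4
  exact hL.domSubdiff_eq hE hf ▸ ⟨ζ, hy⟩

/-- Once some `x N` is Bregman-close to a minimizer `w ∈ int dom f`, monotonicity keeps all later
iterates Bregman-close to the same `w`, hence close in norm. -/
theorem cauchySeq_of_liminf (h : BregmanMinimizing f G ε x) (hε : 0 < ε) (hG : IsGammaZero G)
    (hf : IsGammaZero f) (hd : GateauxOnIntDom f) (hz : z₀ ∈ minimizers G) (hzf : z₀ ∈ intDom f)
    (hb : Bornology.IsBounded (range x)) (hcons : BregmanSeqConsistent f)
    (hlim : liminf (fun n => bregmanDist f (minimizers G) (x n)) atTop = 0) : CauchySeq x := by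
  have hz₀ := intDom_subset_effDom hzf
  rw [Metric.cauchySeq_iff']
  intro δ hδ
  obtain ⟨ρ, hρ, hclose⟩ := hcons.exists_forall_norm_lt hf hd h.mem_intDom hb (half_pos hδ)
  have h1 : ∃ᶠ n in atTop, bregmanDist f (minimizers G) (x n) < ((ρ / 2 : ℝ) : EReal) := by
    refine frequently_lt_of_liminf_lt ?_ ?_
    · exact isCobounded_ge_of_top
    · rw [hlim]
      exact_mod_cast half_pos hρ
  obtain ⟨N, hN⟩ := h1.exists
  rw [bregmanDist] at hN
  simp only [iInf_lt_iff] at hN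
  obtain ⟨z, hzm, hzN⟩ := hN
  have hzd := (hf.mem_effDom_of_bregman_lt_top (hzN.trans (EReal.coe_lt_top _))).1
  rw [hf.bregman_eq hzd (h.mem_intDom N), EReal.coe_lt_coe_iff] at hzN
  set C := realBregman f z₀ (x N) with hC
  have hC0 : 0 ≤ C := realBregman_nonneg hf hd hz₀ (h.mem_intDom N)
  have hz0 : 0 ≤ realBregman f z (x N) := realBregman_nonneg hf hd hzd (h.mem_intDom N)
  -- The near-optimal `z` may lie on the boundary of `dom f`. Mixing in a little of `z₀` moves it
  -- into the interior, and this `t` makes the cost `t * C` less than `ρ / 2`.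
  set t : ℝ := ρ / (2 * (C + ρ)) with ht
  have ht0 : 0 < t := by positivity
  have ht1 : t < 1 := by
    rw [ht, div_lt_one (by positivity)]
    linarith
  have htC : t * C < ρ / 2 := by
    rw [ht, div_mul_eq_mul_div, div_lt_div_iff₀ (by positivity) (by norm_num)]
    nlinarith
  set w := t • z₀ + (1 - t) • z with hw
  have hwm : w ∈ minimizers G :=
    convex_minimizers hG hz hzm ht0.le (by linarith) (by ring)
  have hwf : w ∈ intDom f :=
    hf.convex_effDom.combo_interior_self_mem_interior hzf hzd ht0 (by linarith) (by ring)
  have hwN : realBregman f w (x N) < ρ := by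
    have h2 := realBregman_combo_le hf (y := x N) hz₀ hzd ht0.le ht1.le
    have h3 : (1 - t) * realBregman f z (x N) ≤ realBregman f z (x N) :=
      mul_le_of_le_one_left hz0 (by linarith)
    linarith
  have hclose' : ∀ n ≥ N, ‖w - x n‖ < δ / 2 := fun n hn =>
    hclose n w hwf ((h.antitone hε hG hwm (intDom_subset_effDom hwf) hn).trans_lt hwN)
  refine ⟨N, fun n hn => ?_⟩
  have h2 := dist_triangle_left (x n) (x N) w
  rw [dist_eq_norm w, dist_eq_norm w] at h2
  linarith [hclose' n hn, hclose' N le_rfl]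

end BregmanMinimizing

end Minimizing

section Main

variable {X Y : Type*} [NormedAddCommGroup X] [NormedSpace ℝ X]
  [NormedAddCommGroup Y] [NormedSpace ℝ Y]

/-! ### The forward-backward iteration -/

theorem mem_effDom_of_mem_solutions {φ : X → EReal} (hφ : IsGammaZero φ) {ψ : Y → EReal}
    (hψ : IsGammaZero ψ) {L : X →L[ℝ] Y} {z : X} (hz : z ∈ solutions φ ψ L) :
    z ∈ effDom φ ∧ L z ∈ effDom ψ :=
  (add_lt_top_iff_of_ne_bot (hφ.ne_bot z) (hψ.ne_bot (L z))).1 hz.1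

theorem toReal_objective {φ : X → EReal} (hφ : IsGammaZero φ) {ψ : Y → EReal}
    (hψ : IsGammaZero ψ) {L : X →L[ℝ] Y} {z : X} (hz : z ∈ effDom φ) (hLz : L z ∈ effDom ψ) :
    (φ z + ψ (L z)).toReal = (φ z).toReal + (ψ (L z)).toReal :=
  EReal.toReal_add (ne_of_lt hz) (hφ.ne_bot z) (ne_of_lt hLz) (hψ.ne_bot _)

theorem isGammaZero_objective {φ : X → EReal} (hφ : IsGammaZero φ) {ψ : Y → EReal}
    (hψ : IsGammaZero ψ) {L : X →L[ℝ] Y} {z : X} (hz : z ∈ effDom φ) (hLz : L z ∈ effDom ψ) :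
    IsGammaZero fun x => φ x + ψ (L x) :=
  hφ.add (hψ.comp L ⟨z, hLz⟩) ⟨z, hz, hLz⟩

theorem neg_adj_grad_mem_subdiff {φ : X → EReal} (hφ : IsGammaZero φ) {ψ : Y → EReal}
    (hψ : IsGammaZero ψ) (hψd : GateauxOnIntDom ψ) {L : X →L[ℝ] Y} {z : X}
    (hz : z ∈ solutions φ ψ L) (hLz : L z ∈ intDom ψ) :
    -adj L (grad ψ (L z)) ∈ subdiff φ z := by
  have hzd := mem_effDom_of_mem_solutions hφ hψ hz
  refine HasGateauxDerivAt.neg_mem_subdiff_of_isMin hφ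
    (hψd.hasGateauxDerivAt hLz).comp_clm hzd.1
    (preimage_interior_subset_interior_preimage L.continuous hLz) fun y hy => ?_
  have hyψ : y ∈ effDom fun x => ψ (L x) := intDom_subset_effDom hy.2
  rw [← toReal_objective hφ hψ hzd.1 hzd.2, ← toReal_objective hφ hψ hy.1 hyψ]
  exact toReal_le_of_mem_minimizers (isGammaZero_objective hφ hψ hzd.1 hzd.2) hz
    ((add_lt_top_iff_of_ne_bot (hφ.ne_bot y) (hψ.ne_bot (L y))).2 ⟨hy.1, hyψ⟩)

/-- The forward-backward step is well defined and stays in `int dom f`. -/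
theorem fbStep_eq_singleton (hX : IsReflexiveSpace X) {φ : X → EReal} (hφ : IsGammaZero φ)
    {ψ : Y → EReal} (hψ : IsGammaZero ψ) (hψd : GateauxOnIntDom ψ) {L : X →L[ℝ] Y}
    {f : X → EReal} (hf : IsGammaZero f) (hfL : IsLegendre f)
    (hL : ∀ x ∈ intDom f, L x ∈ intDom ψ)
    (hcof : Cofinite f ∨ ∀ y ∈ intDom ψ, -adj L (grad ψ y) ∈ effDom (conj φ))
    {γ : ℝ} (hγ : 0 < γ) {z : X} (hz : z ∈ solutions φ ψ L) (hzf : z ∈ intDom f) {x : X}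
    (hx : x ∈ intDom f) :
    ∃ p ∈ intDom f, p ∈ effDom φ ∧ fbStep f φ ψ L γ x = {p} ∧
      ∀ w ∈ effDom φ, (grad f x - γ • adj L (grad ψ (L x)) - grad f p) (w - p) +
        γ * (φ p).toReal ≤ γ * (φ w).toReal := by
  have hzd := mem_effDom_of_mem_solutions hφ hψ hz
  rcases hcof with hcof | hran
  -- For cofinite `f` any affine minorant of `φ` will do; optimality of `z` supplies one.
  · have hu := (hφ.mem_subdiff_iff.1 (neg_adj_grad_mem_subdiff hφ hψ hψd hz (hL z hzf))).2
    refine proxOp_scale_eq_singleton hX hφ hf hfL hγ hzd.1 hzf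
      (u := -adj L (grad ψ (L z))) (c := (φ z).toReal - (-adj L (grad ψ (L z))) z)
      (fun w hw => ?_) ?_
    · have := hu w hw
      rw [map_sub] at this
      linarith
    · rw [intDom, show effDom (conj f) = univ from hcof, interior_univ]
      trivial
  -- The minorant of slope `-L*∇ψ(Lx)` cancels the forward term: `ζ - γ u` becomes `∇f(x)`, which
  -- lies in `int dom f*`.
  · have hu := hran (L x) (hL x hx)
    refine proxOp_scale_eq_singleton hX hφ hf hfL hγ hzd.1 hzf
      (u := -adj L (grad ψ (L x))) (c := -(conj φ (-adj L (grad ψ (L x)))).toReal)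
      (fun w hw => ?_) ?_
    · have := hφ.fenchel_young hu hw
      linarith
    · rw [smul_neg, sub_neg_eq_add, sub_add_cancel]
      exact hfL.mem_intDom_conj hX hf (hfL.grad_mem_subdiff hf hx)

theorem tendsto_of_tendsto_map_of_le {u : ℕ → X} {l : X} {L : X →L[ℝ] Y} {κ : ℝ} (hκ : 0 < κ)
    (hL : ∀ z, κ * ‖z‖ ≤ ‖L z‖) (h : Tendsto (fun n => L (u n)) atTop (𝓝 (L l))) :
    Tendsto u atTop (𝓝 l) := by
  rw [tendsto_iff_norm_sub_tendsto_zero] at h ⊢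
  have h1 : Tendsto (fun n => ‖L (u n) - L l‖ / κ) atTop (𝓝 0) := by simpa using h.div_const κ
  refine squeeze_zero (fun n => norm_nonneg _) (fun n => ?_) h1
  rw [le_div_iff₀ hκ, ← map_sub, mul_comm]
  exact hL _

theorem exists_orbit {α : Type*} {P : α → Prop} {R : ℕ → α → α → Prop} {a : α} (ha : P a)
    (h : ∀ n y, P y → ∃ p, P p ∧ R n y p) :
    ∃ x : ℕ → α, x 0 = a ∧ (∀ n, P (x n)) ∧ ∀ n, R n (x n) (x (n + 1)) := by
  choose T hT hR using h
  let s : ℕ → {y // P y} := fun n => Nat.rec ⟨a, ha⟩ (fun n y => ⟨T n y.1 y.2, hT n y.1 y.2⟩) n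
  exact ⟨fun n => (s n).1, rfl, fun n => (s n).2, fun n => hR n (s n).1 (s n).2⟩

end Main

end

end BregmanFB

/-! ### The convergence theorem. -/

open BregmanFB in
theorem theorem3p2 {X Y : Type*}
    [NormedAddCommGroup X] [NormedSpace ℝ X] [CompleteSpace X]
    [NormedAddCommGroup Y] [NormedSpace ℝ Y] [CompleteSpace Y]
    (hX : IsReflexiveSpace X) (hY : IsReflexiveSpace Y)
    (φ : X → EReal) (hφ : IsGammaZero φ)
    (ψ : Y → EReal) (hψ : IsGammaZero ψ) (hψd : GateauxOnIntDom ψ)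
    (L : X →L[ℝ] Y)
    (f : X → EReal) (hf : IsGammaZero f) (hfL : IsLegendre f)
    (hS : (solutions φ ψ L ∩ intDom f).Nonempty)
    (hL : ∀ x ∈ intDom f, L x ∈ intDom ψ)
    (β : ℝ) (hβ : 0 < β)
    (hdom : Dominates f f (scale β (fun x => ψ (L x))))
    (hcof : Cofinite f ∨ ∀ y ∈ intDom ψ, -adj L (grad ψ y) ∈ effDom (conj φ))
    (hcoer : ∀ x ∈ intDom f, Coercive (fun y => bregman f x y))
    (ε : ℝ) (hε : 0 < ε) (hε' : ε < β / (β + 1))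
    (η : ℕ → ℝ) (hη : ∀ n, 0 ≤ η n) (hηs : Summable η)
    (γ : ℕ → ℝ) (hγ : ∀ n, ε ≤ γ n ∧ γ n ≤ β * (1 - ε))
    (hγη : ∀ n, (1 + η n) * γ n - γ (n + 1) ≤ β * η n)
    (x₀ : X) (hx₀ : x₀ ∈ intDom f) :
    ∃ x : ℕ → X, x 0 = x₀ ∧ (∀ n, x n ∈ intDom f) ∧
      (∀ n, fbStep f φ ψ L (γ n) (x n) = {x (n + 1)}) ∧
      ∃ xbar ∈ solutions φ ψ L,
        (((∃ a, solutions φ ψ L ∩ closure (effDom f) = {a}) ∨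
          (GradWeakSeqContinuous f ∧ GradWeakSeqContinuous ψ ∧
            solutions φ ψ L ⊆ intDom f) ∨
          (IsOpen (effDom (conj f)) ∧ GradWeakSeqContinuous f ∧
            GradWeakSeqContinuous (conj f) ∧ GradWeakSeqContinuous ψ)) →
          WeakTendsto x xbar) ∧
        (BregmanSeqConsistent f →
          (UniformlyConvexAt φ xbar ∨
            (UniformlyConvexAt ψ (L xbar) ∧ ∃ κ : ℝ, 0 < κ ∧ ∀ z : X, κ * ‖z‖ ≤ ‖L z‖) ∨
            Filter.liminf (fun n => bregmanDist f (solutions φ ψ L) (x n)) Filter.atTop = 0) →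
          Filter.Tendsto x Filter.atTop (nhds xbar)) := by
  obtain ⟨z₀, hz₀, hz₀f⟩ := hS
  have hγ0 : ∀ n, 0 < γ n := fun n => hε.trans_le (hγ n).1
  have hγβ : ∀ n, γ n ≤ β := fun n => (hγ n).2.trans (by nlinarith)
  obtain ⟨hz₀φ, hz₀ψ⟩ := mem_effDom_of_mem_solutions hφ hψ hz₀
  have hG := isGammaZero_objective hφ hψ hz₀φ hz₀ψ
  obtain ⟨x, hx0, hxf, hx⟩ := exists_orbit (P := fun y => y ∈ intDom f) hx₀
    fun n y hy => fbStep_eq_singleton hX hφ hψ hψd hf hfL hL hcof (hγ0 n) hz₀ hz₀f hy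
  have hxψ : ∀ n, L (x n) ∈ effDom ψ := fun n => intDom_subset_effDom (hL _ (hxf n))
  have hxG : ∀ n, x (n + 1) ∈ effDom fun y => φ y + ψ (L y) := fun n =>
    (add_lt_top_iff_of_ne_bot (hφ.ne_bot _) (hψ.ne_bot _)).2 ⟨(hx n).1, hxψ _⟩
  have hmin : BregmanMinimizing f (fun y => φ y + ψ (L y)) ε x := by
    refine ⟨hxf, hxG, fun z hz hzf n => ?_⟩
    obtain ⟨hzφ, hzψ⟩ := mem_effDom_of_mem_solutions hφ hψ hz
    have h1 := realBregman_step_le hdom hβ hf hψ hψd hL (hγ0 n) (hγβ n) (hxf n) (hxf (n + 1))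
      (hx n).2.2 hzφ hzf
    have h2 := toReal_le_of_mem_minimizers hG hz (hxG n)
    simp only [toReal_objective hφ hψ hzφ hzψ, toReal_objective hφ hψ (hx n).1 (hxψ _)] at h2 ⊢
    have h3 := mul_le_mul_of_nonneg_right (hγ n).1 (sub_nonneg.2 h2)
    linarith
  have hb := hmin.isBounded hε hG hf hz₀ hz₀f (hcoer z₀ hz₀f)
  have hz₀d := intDom_subset_effDom hz₀f
  have hclS : ∀ {k : ℕ → ℕ} {l : X}, Filter.Tendsto k Filter.atTop Filter.atTop →
      WeakTendsto (x ∘ k) l → l ∈ solutions φ ψ L := fun hk hl =>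
    hmin.mem_minimizers hε hG hf hfL.gateaux hz₀ hz₀d hk hl
  -- An arbitrary weak cluster point serves as `xbar` for both conclusions.
  obtain ⟨xbar, k, hk, hxbar⟩ := hX.exists_weakTendsto_subseq hb
  have hxbarS := hclS hk.tendsto_atTop hxbar
  obtain ⟨hxbarφ, hxbarψ⟩ := mem_effDom_of_mem_solutions hφ hψ hxbarS
  refine ⟨x, hx0, hxf, fun n => (hx n).2.1, xbar, hxbarS, fun hw => ?_, fun hcons hc => ?_⟩
  · refine hX.weakTendsto_of_unique hb fun l j hj hl => ?_
    rcases hw with ⟨a, ha⟩ | ⟨hwf, -, hSf⟩ | ⟨hopen, hwf, hwc, -⟩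
    · have h1 : l ∈ ({a} : Set X) := ha ▸ ⟨hclS hj hl, hmin.mem_closure hf hl⟩
      have h2 : xbar ∈ ({a} : Set X) := ha ▸ ⟨hxbarS, hmin.mem_closure hf hxbar⟩
      exact h1.trans h2.symm
    · exact hmin.weak_limit_unique hε hG hf hfL hwf (hclS hj hl) (hSf (hclS hj hl)) hxbarS
        (hSf hxbarS) hj hk.tendsto_atTop hl hxbar
    · have hint : ∀ {k : ℕ → ℕ} {l : X}, WeakTendsto (x ∘ k) l → l ∈ intDom f := fun hl =>
        hmin.mem_intDom_of_weakTendsto hX hε hG hf hfL hz₀ hz₀f hopen hwc hl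
      exact hmin.weak_limit_unique hε hG hf hfL hwf (hclS hj hl) (hint hl) hxbarS
        (hint hxbar) hj hk.tendsto_atTop hl hxbar
  · have hval := (hmin.tendsto_value hε hG hf hfL.gateaux hz₀ hz₀d).const_mul (1 / 2 : ℝ)
    rw [mul_zero] at hval
    have h0 : (0 : ℝ) ≤ 1 / 2 := by norm_num
    have h01 : (1 / 2 + 1 / 2 : ℝ) = 1 := by norm_num
    have hmid : ∀ n, L ((1 / 2 : ℝ) • xbar + (1 / 2 : ℝ) • x (n + 1)) =
        (1 / 2 : ℝ) • L xbar + (1 / 2 : ℝ) • L (x (n + 1)) := fun n => by simp only [map_add, map_smul]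
    have hmidφ := fun n => hφ.convexOn.2 hxbarφ (hx n).1 h0 h0 h01
    have hmidψ := fun n => hψ.convexOn.2 hxbarψ (hxψ (n + 1)) h0 h0 h01
    -- The midpoint value is at least the minimum, so the midpoint gaps of `φ` and of `ψ` (along
    -- `L`) add up to at most half the objective gap. Each is nonnegative, so each alone obeys this
    -- bound.
    have hgap : ∀ n, (φ z₀ + ψ (L z₀)).toReal ≤
        (φ ((1 / 2 : ℝ) • xbar + (1 / 2 : ℝ) • x (n + 1))).toReal +
          (ψ ((1 / 2 : ℝ) • L xbar + (1 / 2 : ℝ) • L (x (n + 1)))).toReal := fun n => by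
      have hmφ := hφ.convex_effDom hxbarφ (hx n).1 h0 h0 h01
      have hmψ := hψ.convex_effDom hxbarψ (hxψ (n + 1)) h0 h0 h01
      rw [← hmid] at hmψ ⊢
      rw [← toReal_objective hφ hψ hmφ hmψ]
      exact toReal_le_of_mem_minimizers hG hz₀
        ((add_lt_top_iff_of_ne_bot (hφ.ne_bot _) (hψ.ne_bot _)).2 ⟨hmφ, hmψ⟩)
    have hxbarz : (φ xbar).toReal + (ψ (L xbar)).toReal ≤ (φ z₀ + ψ (L z₀)).toReal := by
      rw [← toReal_objective hφ hψ hxbarφ hxbarψ]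
      exact toReal_le_of_mem_minimizers hG hxbarS hz₀.1
    have hxn := fun n => toReal_objective hφ hψ (hx n).1 (hxψ (n + 1))
    simp only [smul_eq_mul] at hmidφ hmidψ
    -- Only the iterates from index `1` on are known to lie in `dom φ`.
    rw [← Filter.tendsto_add_atTop_iff_nat 1]
    rcases hc with huc | ⟨huc, κ, hκ, hLκ⟩ | hlim
    · refine huc.tendsto_of_midpoint hφ (fun n => (hx n).1) hval fun n => ?_
      rw [hxn]
      linarith [hmidψ n, hgap n]
    · refine tendsto_of_tendsto_map_of_le hκ hLκ
        (huc.tendsto_of_midpoint hψ (fun n => hxψ (n + 1)) hval fun n => ?_)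
      rw [hxn]
      linarith [hmidφ n, hgap n]
    · obtain ⟨l, hl⟩ := cauchySeq_tendsto_of_complete
        (hmin.cauchySeq_of_liminf hε hG hf hfL.gateaux hz₀ hz₀f hb hcons hlim)
      have h1 : WeakTendsto (x ∘ k) l := weakTendsto_iff.2 fun ζ =>
        (ζ.continuous.tendsto l).comp (hl.comp hk.tendsto_atTop)
      rw [hxbar.unique h1]
      exact hl.comp (Filter.tendsto_add_atTop_nat 1)
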